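/- Let $\Lambda=\mathbb{Q}[m,l^{\pm1}]$ with field of fractions $F$, put $\tau=\frac{l-l^{-1}}{m}+1\in F$, and let $n\ge 1$. Let $R$ be any ring with $\Lambda\subseteq R\subseteq F$ and $\tau\in R$ (for example $R=\Lambda[\tau]$, the smallest such ring, or $R=\mathbb{Q}[m^{\pm1},l^{\pm1}]$). Write $[ab\dots]_k$ for the alternating product of length $k$ starting with $a$, and $[\dots ab]_k$ for the alternating product of length $k$ ending with $b$. Let $\bar B_R$ be the associative unital $R$-algebra generated by $X_0^{\pm1},X_1^{\pm1},E_0,E_1$ subject to the relations 1. $[X_0X_1\dots]_{2n+1}=[X_1X_0\dots]_{2n+1}$; 2. $X_i-X_i^{-1}=m(E_i-1)$ for $i=0,1$; 3. $X_iE_i=E_iX_i=lE_i$ for $i=0,1$; 4. $E_i^2=\tau E_i$ for $i=0,1$; 5. $E_0[X_1X_0\dots]_{2i-1}E_0=l^{-1}E_0$ for $1\le i\le n$; 6. $E_1[X_0X_1\dots]_{2i-1}E_1=l^{-1}E_1$ for $1\le i\le n$; 7. $E_0[X_1^{-1}X_0^{-1}\dots]_{2i-1}E_0=lE_0$ for $1\le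 i\le n$; 8. $E_1[X_0^{-1}X_1^{-1}\dots]_{2i-1}E_1=lE_1$ for $1\le i\le n$; 9. $[X_0X_1\dots]_{2n}E_0=E_1[X_0X_1\dots]_{2n}$; 10. $E_0[X_1X_0\dots]_{2n}=[X_1X_0\dots]_{2n}E_1$. Let $B$ be the $F$-algebra with the same presentation. In $B$ consider the family $\Sigma$ consisting of the elements $[X_1X_0\dots]_i$ ($0\le i\le 2n$), $[X_0X_1\dots]_j$ ($1\le j\le 2n+1$) and $[\dots X_0X_1]_aE_0[X_1X_0\dots]_b$ ($0\le a,b\le 2n$), and let $A_n\subseteq B$ be its $R$-linear span. Then: (a) $\Sigma$ is an $F$-basis of $B$, and the structure constants of $B$ with respect to $\Sigma$ all lie in $R$. (b) $A_n$ is an $R$-subalgebra of $B$, and there is an isomorphism of $R$-algebras $\bar B_R\to A_n$ which sends each generator $X_i^{\pm1},E_i$ of $\bar B_R$ to the generator of $B$ with the same name. (c) Consequently $\bar B_R$ is a free $R$-module of finite rank $2(2n+1)+(2n+1)^2$. -/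

import Mathlib

open scoped LaurentPolynomial Polynomial

noncomputable section

namespace DihedralBMW

/-- The alternating product `[a b a …]_k` of length `k` that starts with `a`. -/
def altFrom {A : Type*} [Monoid A] (a b : A) : ℕ → A
  | 0 => 1
  | k + 1 => a * altFrom b a k

/-- The alternating product `[… b a b]_k` of length `k` that ends with `b`. -/
def altTo {A : Type*} [Monoid A] (a b : A) : ℕ → A
  | 0 => 1
  | k + 1 => altTo b a k * b

/-- Symbols for the generators: `X i` is `X_i`, `Xinv i` is its inverse, `E i` is `E_i`. -/
inductive Gen : Type
  | X (i : Fin 2)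
  | Xinv (i : Fin 2)
  | E (i : Fin 2)

section Presentation

variable (R : Type*) [CommRing R]

/-- The generator `X_i` in the free algebra. -/
abbrev fX (i : Fin 2) : FreeAlgebra R Gen := FreeAlgebra.ι R (Gen.X i)

/-- The generator `X_i⁻¹` in the free algebra. -/
abbrev fXinv (i : Fin 2) : FreeAlgebra R Gen := FreeAlgebra.ι R (Gen.Xinv i)

/-- The generator `E_i` in the free algebra. -/
abbrev fE (i : Fin 2) : FreeAlgebra R Gen := FreeAlgebra.ι R (Gen.E i)

/-- The defining relations of the BMW type algebra of type `I₂(2n+1)` with parameters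
`m`, `l` (invertible) and `τ`. -/
inductive Rel (m : R) (l : Rˣ) (τ : R) (n : ℕ) :
    FreeAlgebra R Gen → FreeAlgebra R Gen → Prop
  | X_mul_Xinv (i : Fin 2) : Rel m l τ n (fX R i * fXinv R i) 1
  | Xinv_mul_X (i : Fin 2) : Rel m l τ n (fXinv R i * fX R i) 1
  | braid : Rel m l τ n (altFrom (fX R 0) (fX R 1) (2 * n + 1))
      (altFrom (fX R 1) (fX R 0) (2 * n + 1))
  | skein (i : Fin 2) : Rel m l τ n (fX R i - fXinv R i) (m • (fE R i - 1))
  | X_mul_E (i : Fin 2) : Rel m l τ n (fX R i * fE R i) ((l : R) • fE R i)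
  | E_mul_X (i : Fin 2) : Rel m l τ n (fE R i * fX R i) ((l : R) • fE R i)
  | E_mul_E (i : Fin 2) : Rel m l τ n (fE R i * fE R i) (τ • fE R i)
  | E₀_X_E₀ (i : ℕ) (h1 : 1 ≤ i) (hn : i ≤ n) :
      Rel m l τ n (fE R 0 * altFrom (fX R 1) (fX R 0) (2 * i - 1) * fE R 0)
        (((l⁻¹ : Rˣ) : R) • fE R 0)
  | E₁_X_E₁ (i : ℕ) (h1 : 1 ≤ i) (hn : i ≤ n) :
      Rel m l τ n (fE R 1 * altFrom (fX R 0) (fX R 1) (2 * i - 1) * fE R 1)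
        (((l⁻¹ : Rˣ) : R) • fE R 1)
  | E₀_Xinv_E₀ (i : ℕ) (h1 : 1 ≤ i) (hn : i ≤ n) :
      Rel m l τ n (fE R 0 * altFrom (fXinv R 1) (fXinv R 0) (2 * i - 1) * fE R 0)
        ((l : R) • fE R 0)
  | E₁_Xinv_E₁ (i : ℕ) (h1 : 1 ≤ i) (hn : i ≤ n) :
      Rel m l τ n (fE R 1 * altFrom (fXinv R 0) (fXinv R 1) (2 * i - 1) * fE R 1)
        ((l : R) • fE R 1)
  | slide_E₀ : Rel m l τ n (altFrom (fX R 0) (fX R 1) (2 * n) * fE R 0)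
      (fE R 1 * altFrom (fX R 0) (fX R 1) (2 * n))
  | slide_E₁ : Rel m l τ n (fE R 0 * altFrom (fX R 1) (fX R 0) (2 * n))
      (altFrom (fX R 1) (fX R 0) (2 * n) * fE R 1)

end Presentation

/-- The `R`-algebra presented by the generators `X_i^{±1}`, `E_i` (`i = 0, 1`) and the relations
of type `I₂(2n+1)` with parameters `m`, `l`, `τ` in `R`. -/
abbrev BMW (R : Type*) [CommRing R] (m : R) (l : Rˣ) (τ : R) (n : ℕ) : Type _ :=
  RingQuot (Rel R m l τ n)

/-- The image of a generator in the presented algebra. -/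
def gen {R : Type*} [CommRing R] (m : R) (l : Rˣ) (τ : R) (n : ℕ) (g : Gen) : BMW R m l τ n :=
  RingQuot.mkAlgHom R (Rel R m l τ n) (FreeAlgebra.ι R g)

/-- The ring `Λ = ℚ[m, l^{±1}]`; the polynomial variable is `m`, the Laurent variable is `l`. -/
abbrev Lam : Type := ℚ[X][T;T⁻¹]

/-- The variable `m` of `Λ`. -/
def mLam : Lam := LaurentPolynomial.C Polynomial.X

/-- The variable `l` of `Λ`, a unit with inverse `l⁻¹`. -/
def lLam : Lamˣ where
  val := LaurentPolynomial.T 1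
  inv := LaurentPolynomial.T (-1)
  val_inv := by rw [← LaurentPolynomial.T_add]; simp
  inv_val := by rw [← LaurentPolynomial.T_add]; simp

/-- The field of fractions `F_Λ` of `Λ`. -/
abbrev FLam : Type := FractionRing Lam

/-- `τ = (l - l⁻¹) / m + 1`, an element of `F_Λ`. -/
def tau : FLam :=
  (algebraMap Lam FLam (lLam : Lam) - algebraMap Lam FLam ((lLam⁻¹ : Lamˣ) : Lam)) /
    algebraMap Lam FLam mLam + 1

/-- The algebra `B_{I₂(2n+1)}(m, l)` over the field `F_Λ`. -/
abbrev B (n : ℕ) : Type :=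
  BMW FLam (algebraMap Lam FLam mLam) (Units.map (algebraMap Lam FLam) lLam) tau n

/-- The generators of `B_{I₂(2n+1)}(m, l)`. -/
def bGen (n : ℕ) (g : Gen) : B n := gen _ _ _ n g

/-- The integral form `B̄_{I₂(2n+1)}(m, l)`: the same presentation over a ring `R` of
coefficients with `Λ ⊆ R ⊆ F_Λ` and `τ ∈ R`. -/
abbrev BBar (R : Subalgebra Lam FLam) (hτ : tau ∈ R) (n : ℕ) : Type :=
  BMW R (algebraMap Lam R mLam) (Units.map (algebraMap Lam R) lLam) ⟨tau, hτ⟩ n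

/-- The generators of the integral form. -/
def bBarGen (R : Subalgebra Lam FLam) (hτ : tau ∈ R) (n : ℕ) (g : Gen) : BBar R hτ n :=
  gen _ _ _ n g

/-- Indices of the family `Σ = Σ₂ ∪ Σ₁`. -/
abbrev SigmaIdx (n : ℕ) : Type :=
  (Fin (2 * n + 1) ⊕ Fin (2 * n + 1)) ⊕ (Fin (2 * n + 1) × Fin (2 * n + 1))

/-- The family `Σ`: the words `[X₁X₀…]_i` (`0 ≤ i ≤ 2n`) and `[X₀X₁…]_j` (`1 ≤ j ≤ 2n+1`)
of `Σ₂`, and the elements `[…X₀X₁]_a E₀ [X₁X₀…]_b` (`0 ≤ a, b ≤ 2n`) of `Σ₁`. -/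
def sigma (n : ℕ) : SigmaIdx n → B n
  | Sum.inl (Sum.inl i) => altFrom (bGen n (Gen.X 1)) (bGen n (Gen.X 0)) i
  | Sum.inl (Sum.inr j) => altFrom (bGen n (Gen.X 0)) (bGen n (Gen.X 1)) (j + 1)
  | Sum.inr (a, b) =>
      altTo (bGen n (Gen.X 0)) (bGen n (Gen.X 1)) a * bGen n (Gen.E 0) *
        altFrom (bGen n (Gen.X 1)) (bGen n (Gen.X 0)) b

/-- `A_n`, the span of `Σ` over the ring `R` of coefficients. -/
def An (R : Subalgebra Lam FLam) (n : ℕ) : Submodule R (B n) :=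
  Submodule.span R (Set.range (sigma n))

end DihedralBMW

end

/-!
The span of `Σ` contains `1` and is a left ideal, so `Σ` spans the presented algebra over every
ring of coefficients: the elements `[… X₀ X₁]_a E₀` span the left ideal generated by `E₀`, and the
anti-automorphism that fixes the generators turns this into a statement about two-sided ideals.

For the linear independence, the quotient by the `E_i` is the Hecke algebra of the dihedral group,
which separates the words of `Σ₂`. The span of the rest of `Σ` is the two-sided ideal generated by
`E₀`. Its elements `[… X₀ X₁]_a E₀ [X₁⁻¹ X₀⁻¹ …]_b` act on the cell module with basis
`[… X₀ X₁]_a E₀` by the operators of rank one `v ↦ f_b(v) [… X₀ X₁]_a E₀`. If the Gram matrix whose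
rows are the `f_b` is invertible, then these operators span all endomorphisms, so the rest of `Σ`
acts by a spanning family and is independent by a count of dimensions. Over the
universal ring of coefficients `ℤ[m, l^{±1}, τ] / (m τ - l + l⁻¹ - m)`, which is a domain, the Gram
determinant is nonzero since at `m = 0`, `l = 1` it is a characteristic polynomial. So `Σ` is
independent there, and by base change over every ring in which `m τ = l - l⁻¹ + m`. Hence `Σ` is a
basis of both algebras in the theorem, and the natural map between them matches the two bases.
-/

open scoped TensorProduct

noncomputable section

namespace DihedralBMW

section AlternatingWords

variable {A : Type*} [Monoid A]

theorem altFrom_succ (a b : A) (k : ℕ) : altFrom a b (k + 1) = a * altFrom b a k := rfl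

theorem altTo_succ (a b : A) (k : ℕ) : altTo a b (k + 1) = altTo b a k * b := rfl

theorem altFrom_odd_and_even (a b : A) (k : ℕ) :
    altFrom a b (2 * k + 1) = altFrom a b (2 * k) * a ∧
      altFrom a b (2 * k + 2) = altFrom a b (2 * k + 1) * b := by
  induction k with
  | zero => simp [altFrom]
  | succ k ih =>
    constructor
    · calc altFrom a b (2 * k + 3) = a * (b * altFrom a b (2 * k + 1)) := rfl
        _ = a * (b * altFrom a b (2 * k)) * a := by simp only [ih.1, mul_assoc]
    · calc altFrom a b (2 * k + 4) = a * (b * altFrom a b (2 * k + 2)) := rfl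
        _ = a * (b * altFrom a b (2 * k + 1)) * b := by simp only [ih.2, mul_assoc]

theorem altFrom_odd (a b : A) (k : ℕ) : altFrom a b (2 * k + 1) = altFrom a b (2 * k) * a :=
  (altFrom_odd_and_even a b k).1

theorem altFrom_even (a b : A) (k : ℕ) :
    altFrom a b (2 * k + 2) = altFrom a b (2 * k + 1) * b :=
  (altFrom_odd_and_even a b k).2

theorem altTo_even_and_odd_eq (a b : A) (k : ℕ) :
    altTo a b (2 * k) = altFrom a b (2 * k) ∧ altTo b a (2 * k + 1) = altFrom a b (2 * k + 1) := by
  induction k with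
  | zero => simp [altFrom, altTo]
  | succ k ih =>
    have even : altTo a b (2 * (k + 1)) = altFrom a b (2 * (k + 1)) := by
      rw [mul_add_one, altTo_succ, ih.2, altFrom_even]
    exact ⟨even, by rw [altTo_succ, even, altFrom_odd]⟩

theorem altTo_even_eq (a b : A) (k : ℕ) : altTo a b (2 * k) = altFrom a b (2 * k) :=
  (altTo_even_and_odd_eq a b k).1

theorem altTo_odd_eq (a b : A) (k : ℕ) : altTo a b (2 * k + 1) = altFrom b a (2 * k + 1) :=
  (altTo_even_and_odd_eq b a k).2

theorem altTo_odd (a b : A) (k : ℕ) : altTo a b (2 * k + 1) = b * altTo a b (2 * k) := by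
  rw [altTo_odd_eq, altFrom_succ, altTo_even_eq]

theorem altTo_even (a b : A) (k : ℕ) : altTo a b (2 * k + 2) = a * altTo a b (2 * k + 1) := by
  rw [altTo_odd_eq, ← altFrom_succ, ← mul_add_one 2 k, altTo_even_eq]

theorem map_altFrom {C F : Type*} [Monoid C] [FunLike F A C] [MonoidHomClass F A C] (f : F)
    (a b : A) (k : ℕ) : f (altFrom a b k) = altFrom (f a) (f b) k := by
  induction k generalizing a b with
  | zero => simp [altFrom]
  | succ k ih => simp [altFrom, ih]

theorem map_altTo {C F : Type*} [Monoid C] [FunLike F A C] [MonoidHomClass F A C] (f : F)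
    (a b : A) (k : ℕ) : f (altTo a b k) = altTo (f a) (f b) k := by
  induction k generalizing a b with
  | zero => simp [altTo]
  | succ k ih => simp [altTo, ih]

theorem op_altFrom (a b : A) (k : ℕ) :
    MulOpposite.op (altFrom a b k) = altTo (MulOpposite.op b) (MulOpposite.op a) k := by
  induction k generalizing a b with
  | zero => simp [altFrom, altTo]
  | succ k ih => simp [altFrom, altTo, ih]

theorem op_altTo (a b : A) (k : ℕ) :
    MulOpposite.op (altTo a b k) = altFrom (MulOpposite.op b) (MulOpposite.op a) k := by
  induction k generalizing a b with
  | zero => simp [altFrom, altTo]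
  | succ k ih => simp [altFrom, altTo, ih]

theorem op_altFrom_even (a b : A) (k : ℕ) :
    MulOpposite.op (altFrom a b (2 * k)) =
      altFrom (MulOpposite.op b) (MulOpposite.op a) (2 * k) := by
  rw [op_altFrom, altTo_even_eq]

theorem op_altFrom_odd (a b : A) (k : ℕ) :
    MulOpposite.op (altFrom a b (2 * k + 1)) =
      altFrom (MulOpposite.op a) (MulOpposite.op b) (2 * k + 1) := by
  rw [op_altFrom, altTo_odd_eq]

theorem altTo_mul_altFrom {x y x' y' : A} (hx : x * x' = 1) (hy : y * y' = 1) (k : ℕ) :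
    altTo x y k * altFrom y' x' k = 1 := by
  induction k generalizing x y x' y' with
  | zero => simp [altFrom, altTo]
  | succ k ih =>
    rw [altTo_succ, altFrom_succ, mul_assoc, ← mul_assoc y, hy, one_mul, ih hy hx]

theorem altFrom_add_mul_altFrom {x y x' y' : A} (hx : x' * x = 1) (hy : y' * y = 1) (j k : ℕ) :
    altFrom y' x' (2 * (j + k)) * altFrom x y (2 * k) = altFrom y' x' (2 * j) := by
  rw [← altTo_even_eq y' x' (j + k)]
  induction k with
  | zero => simp [altFrom, altTo_even_eq]
  | succ k ih =>
    calc altTo y' x' (2 * (j + k) + 2) * altFrom x y (2 * k + 2)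
        = altTo y' x' (2 * (j + k)) * (y' * ((x' * x) * (y * altFrom x y (2 * k)))) := by
          simp only [altTo_succ, altFrom_succ, mul_assoc]
      _ = altFrom y' x' (2 * j) := by rw [hx, one_mul, ← mul_assoc y', hy, one_mul, ih]

theorem isUnit_altFrom {a b : A} (ha : IsUnit a) (hb : IsUnit b) (k : ℕ) :
    IsUnit (altFrom a b k) := by
  induction k generalizing a b with
  | zero => exact isUnit_one
  | succ k ih => exact ha.mul (ih hb ha)

theorem semiconjBy_altFrom {d a b a' b' : A} (ha : SemiconjBy d a a') (hb : SemiconjBy d b b')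
    (k : ℕ) : SemiconjBy d (altFrom a b k) (altFrom a' b' k) := by
  induction k generalizing a b a' b' with
  | zero => exact SemiconjBy.one_right d
  | succ k ih => exact ha.mul_right (ih hb ha)

end AlternatingWords

/-- The families `x`, `y`, `e` of elements of an `R`-algebra satisfy the defining relations of
`BMW R m l τ n` for `X_i`, `X_i⁻¹` and `E_i`. The two indices enter symmetrically, `i.rev` being
the one other than `i`. -/
structure Satisfies {R A : Type*} [CommRing R] [Ring A] [Algebra R A] (m : R) (l : Rˣ) (τ : R)
    (n : ℕ) (x y e : Fin 2 → A) : Prop where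
  x_mul_y (i : Fin 2) : x i * y i = 1
  y_mul_x (i : Fin 2) : y i * x i = 1
  braid : altFrom (x 0) (x 1) (2 * n + 1) = altFrom (x 1) (x 0) (2 * n + 1)
  skein (i : Fin 2) : x i - y i = m • (e i - 1)
  x_mul_e (i : Fin 2) : x i * e i = (l : R) • e i
  e_mul_x (i : Fin 2) : e i * x i = (l : R) • e i
  e_mul_e (i : Fin 2) : e i * e i = τ • e i
  e_x_e (i : Fin 2) (k : ℕ) (hk : k < n) :
    e i * altFrom (x i.rev) (x i) (2 * k + 1) * e i = ((l⁻¹ : Rˣ) : R) • e i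
  e_y_e (i : Fin 2) (k : ℕ) (hk : k < n) :
    e i * altFrom (y i.rev) (y i) (2 * k + 1) * e i = (l : R) • e i
  slide (i : Fin 2) :
    altFrom (x i) (x i.rev) (2 * n) * e i = e i.rev * altFrom (x i) (x i.rev) (2 * n)

section UniversalProperty

variable {R A : Type*} [CommRing R] [Ring A] [Algebra R A]

section

variable (m : R) (l : Rˣ) (τ : R) (n : ℕ)

theorem mkAlgHom_eq_of_rel {a b : FreeAlgebra R Gen} (h : Rel R m l τ n a b) :
    RingQuot.mkAlgHom R (Rel R m l τ n) a = RingQuot.mkAlgHom R (Rel R m l τ n) b :=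
  RingQuot.mkAlgHom_rel R h

theorem satisfies_gen : Satisfies m l τ n (gen m l τ n ∘ Gen.X)
    (gen m l τ n ∘ Gen.Xinv) (gen m l τ n ∘ Gen.E) where
  x_mul_y i := by simpa [gen] using mkAlgHom_eq_of_rel m l τ n (Rel.X_mul_Xinv i)
  y_mul_x i := by simpa [gen] using mkAlgHom_eq_of_rel m l τ n (Rel.Xinv_mul_X i)
  braid := by simpa [gen, map_altFrom] using mkAlgHom_eq_of_rel m l τ n Rel.braid
  skein i := by simpa [gen] using mkAlgHom_eq_of_rel m l τ n (Rel.skein i)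
  x_mul_e i := by
    simpa only [gen, map_mul, map_smul] using! mkAlgHom_eq_of_rel m l τ n (Rel.X_mul_E i)
  e_mul_x i := by
    simpa only [gen, map_mul, map_smul] using! mkAlgHom_eq_of_rel m l τ n (Rel.E_mul_X i)
  e_mul_e i := by
    simpa only [gen, map_mul, map_smul] using! mkAlgHom_eq_of_rel m l τ n (Rel.E_mul_E i)
  e_x_e := by
    refine Fin.forall_fin_two.2 ⟨fun k hk => ?_, fun k hk => ?_⟩
    · simpa only [gen, map_mul, map_smul, map_altFrom]
        using! mkAlgHom_eq_of_rel m l τ n (Rel.E₀_X_E₀ (k + 1) k.succ_pos hk)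
    · simpa only [gen, map_mul, map_smul, map_altFrom]
        using! mkAlgHom_eq_of_rel m l τ n (Rel.E₁_X_E₁ (k + 1) k.succ_pos hk)
  e_y_e := by
    refine Fin.forall_fin_two.2 ⟨fun k hk => ?_, fun k hk => ?_⟩
    · simpa only [gen, map_mul, map_smul, map_altFrom]
        using! mkAlgHom_eq_of_rel m l τ n (Rel.E₀_Xinv_E₀ (k + 1) k.succ_pos hk)
    · simpa only [gen, map_mul, map_smul, map_altFrom]
        using! mkAlgHom_eq_of_rel m l τ n (Rel.E₁_Xinv_E₁ (k + 1) k.succ_pos hk)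
  slide := by
    refine Fin.forall_fin_two.2 ⟨?_, ?_⟩
    · simpa only [gen, map_mul, map_altFrom] using! mkAlgHom_eq_of_rel m l τ n Rel.slide_E₀
    · simpa only [gen, map_mul, map_altFrom] using!
        (mkAlgHom_eq_of_rel m l τ n Rel.slide_E₁).symm

end

/-- The assignment on the symbols `X_i`, `X_i⁻¹`, `E_i` given by three families, from which
`Satisfies.lift` is built. -/
def genValue (x y e : Fin 2 → A) : Gen → A
  | Gen.X i => x i
  | Gen.Xinv i => y i
  | Gen.E i => e i

variable {m : R} {l : Rˣ} {τ : R} {n : ℕ} {x y e : Fin 2 → A}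

theorem Satisfies.lift_genValue_eq (h : Satisfies m l τ n x y e) {a b : FreeAlgebra R Gen}
    (hab : Rel R m l τ n a b) :
    FreeAlgebra.lift R (genValue x y e) a = FreeAlgebra.lift R (genValue x y e) b := by
  cases hab with
  | X_mul_Xinv i => simpa [genValue] using! h.x_mul_y i
  | Xinv_mul_X i => simpa [genValue] using! h.y_mul_x i
  | braid => simpa [genValue, map_altFrom] using! h.braid
  | skein i => simpa [genValue] using! h.skein i
  | X_mul_E i =>
    simpa only [map_mul, map_smul, FreeAlgebra.lift_ι_apply, genValue]
      using! h.x_mul_e i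
  | E_mul_X i =>
    simpa only [map_mul, map_smul, FreeAlgebra.lift_ι_apply, genValue]
      using! h.e_mul_x i
  | E_mul_E i =>
    simpa only [map_mul, map_smul, FreeAlgebra.lift_ι_apply, genValue]
      using! h.e_mul_e i
  | E₀_X_E₀ i h1 hn =>
    obtain ⟨k, rfl⟩ := Nat.exists_eq_add_of_le' h1
    simpa only [map_mul, map_smul, map_altFrom, FreeAlgebra.lift_ι_apply, genValue]
      using! h.e_x_e 0 k hn
  | E₁_X_E₁ i h1 hn =>
    obtain ⟨k, rfl⟩ := Nat.exists_eq_add_of_le' h1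
    simpa only [map_mul, map_smul, map_altFrom, FreeAlgebra.lift_ι_apply, genValue]
      using! h.e_x_e 1 k hn
  | E₀_Xinv_E₀ i h1 hn =>
    obtain ⟨k, rfl⟩ := Nat.exists_eq_add_of_le' h1
    simpa only [map_mul, map_smul, map_altFrom, FreeAlgebra.lift_ι_apply, genValue]
      using! h.e_y_e 0 k hn
  | E₁_Xinv_E₁ i h1 hn =>
    obtain ⟨k, rfl⟩ := Nat.exists_eq_add_of_le' h1
    simpa only [map_mul, map_smul, map_altFrom, FreeAlgebra.lift_ι_apply, genValue]
      using! h.e_y_e 1 k hn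
  | slide_E₀ =>
    simpa only [map_mul, map_altFrom, FreeAlgebra.lift_ι_apply, genValue]
      using! h.slide 0
  | slide_E₁ =>
    simpa only [map_mul, map_altFrom, FreeAlgebra.lift_ι_apply, genValue]
      using! (h.slide 1).symm

/-- The universal property of the presentation: the algebra homomorphism out of `BMW R m l τ n`
that sends `X_i`, `X_i⁻¹`, `E_i` to `x i`, `y i`, `e i`. -/
def Satisfies.lift (h : Satisfies m l τ n x y e) : BMW R m l τ n →ₐ[R] A :=
  RingQuot.liftAlgHom R ⟨FreeAlgebra.lift R (genValue x y e), fun {_ _} => h.lift_genValue_eq⟩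

theorem Satisfies.lift_gen (h : Satisfies m l τ n x y e) (g : Gen) :
    h.lift (gen m l τ n g) = genValue x y e g := by
  simp [lift, gen]

theorem Satisfies.map {C : Type*} [Ring C] [Algebra R C] (h : Satisfies m l τ n x y e)
    (f : A →ₐ[R] C) : Satisfies m l τ n (f ∘ x) (f ∘ y) (f ∘ e) where
  x_mul_y i := by simpa using! congrArg f (h.x_mul_y i)
  y_mul_x i := by simpa using! congrArg f (h.y_mul_x i)
  braid := by simpa only [map_altFrom] using! congrArg f h.braid
  skein i := by simpa using! congrArg f (h.skein i)
  x_mul_e i := by simpa only [map_mul, map_smul] using! congrArg f (h.x_mul_e i)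
  e_mul_x i := by simpa only [map_mul, map_smul] using! congrArg f (h.e_mul_x i)
  e_mul_e i := by simpa only [map_mul, map_smul] using! congrArg f (h.e_mul_e i)
  e_x_e i k hk := by
    simpa only [map_mul, map_smul, map_altFrom] using! congrArg f (h.e_x_e i k hk)
  e_y_e i k hk := by
    simpa only [map_mul, map_smul, map_altFrom] using! congrArg f (h.e_y_e i k hk)
  slide i := by simpa only [map_mul, map_altFrom] using! congrArg f (h.slide i)

theorem satisfies_algebraMap_iff {S : Type*} [CommRing S] [Algebra S A] [Algebra S R]
    [IsScalarTower S R A] {m : S} {l : Sˣ} {τ : S} :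
    Satisfies (algebraMap S R m) (Units.map (algebraMap S R) l) (algebraMap S R τ) n x y e ↔
      Satisfies m l τ n x y e := by
  constructor <;> rintro ⟨xy, yx, braid, skein, xe, ex, ee, exe, eye, slide⟩
  · simp only [← map_inv, Units.coe_map, MonoidHom.coe_coe, algebraMap_smul]
      at skein xe ex ee exe eye
    exact ⟨xy, yx, braid, skein, xe, ex, ee, exe, eye, slide⟩
  · constructor <;>
      simpa only [← map_inv, Units.coe_map, MonoidHom.coe_coe, algebraMap_smul]

theorem Satisfies.op (h : Satisfies m l τ n x y e) :
    Satisfies m l τ n (fun i => MulOpposite.op (x i)) (fun i => MulOpposite.op (y i))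
      (fun i => MulOpposite.op (e i)) where
  x_mul_y i := by rw [← MulOpposite.op_mul, h.y_mul_x, MulOpposite.op_one]
  y_mul_x i := by rw [← MulOpposite.op_mul, h.x_mul_y, MulOpposite.op_one]
  braid := by rw [← op_altFrom_odd, ← op_altFrom_odd, h.braid]
  skein i := by rw [← MulOpposite.op_sub, h.skein, MulOpposite.op_smul]; rfl
  x_mul_e i := by rw [← MulOpposite.op_mul, h.e_mul_x, MulOpposite.op_smul]
  e_mul_x i := by rw [← MulOpposite.op_mul, h.x_mul_e, MulOpposite.op_smul]
  e_mul_e i := by rw [← MulOpposite.op_mul, h.e_mul_e, MulOpposite.op_smul]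
  e_x_e i k hk := by
    rw [← op_altFrom_odd, ← MulOpposite.op_mul, ← MulOpposite.op_mul, ← mul_assoc, h.e_x_e i k hk,
      MulOpposite.op_smul]
  e_y_e i k hk := by
    rw [← op_altFrom_odd, ← MulOpposite.op_mul, ← MulOpposite.op_mul, ← mul_assoc, h.e_y_e i k hk,
      MulOpposite.op_smul]
  slide i := by
    have slide_rev := h.slide i.rev
    rw [Fin.rev_rev] at slide_rev
    rw [← op_altFrom_even, ← MulOpposite.op_mul, ← MulOpposite.op_mul, slide_rev]

end UniversalProperty

theorem eq_or_eq_rev (i j : Fin 2) : j = i ∨ j = i.rev := by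
  decide +revert

section Spanning

variable {R A : Type*} [CommRing R] [Ring A] [Algebra R A]

theorem mul_mem_of_mem_span {s : Set A} {S : Submodule R A} {t : A} (h : ∀ z ∈ s, t * z ∈ S)
    {z : A} (hz : z ∈ Submodule.span R s) : t * z ∈ S :=
  (Submodule.span_le.2 h : _ ≤ S.comap (LinearMap.mulLeft R t)) hz

theorem mul_altFrom_mem {S : Submodule R A} {a b : A} (ha : ∀ z ∈ S, z * a ∈ S)
    (hb : ∀ z ∈ S, z * b ∈ S) (k : ℕ) {z : A} (hz : z ∈ S) : z * altFrom a b k ∈ S := by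
  induction k generalizing z a b with
  | zero => simpa [altFrom] using hz
  | succ k ih => rw [altFrom_succ, ← mul_assoc]; exact ih hb ha (ha z hz)

/-- The family `Σ` built from families `x`, `e` standing for the `X_i` and `E_i`. -/
def sigmaOf {A : Type*} [Monoid A] (n : ℕ) (x e : Fin 2 → A) : SigmaIdx n → A
  | Sum.inl (Sum.inl i) => altFrom (x 1) (x 0) i
  | Sum.inl (Sum.inr j) => altFrom (x 0) (x 1) (j + 1)
  | Sum.inr (a, b) => altTo (x 0) (x 1) a * e 0 * altFrom (x 1) (x 0) b

theorem map_sigmaOf {A C F : Type*} [Monoid A] [Monoid C] [FunLike F A C] [MonoidHomClass F A C]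
    (f : F) (n : ℕ) (x e : Fin 2 → A) (i : SigmaIdx n) :
    f (sigmaOf n x e i) = sigmaOf n (f ∘ x) (f ∘ e) i := by
  rcases i with (i | j) | ⟨a, b⟩ <;> simp [sigmaOf, map_altFrom, map_altTo]

/-- The span of the elements `[… x₀ x₁]_a e₀` with `a ≤ 2n`. Under the defining relations it is the
left ideal generated by `e₀`. -/
def leftCell (R : Type*) {A : Type*} [CommRing R] [Ring A] [Algebra R A] (n : ℕ)
    (x e : Fin 2 → A) : Submodule R A :=
  Submodule.span R (Set.range fun a : Fin (2 * n + 1) => altTo (x 0) (x 1) a * e 0)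

/-- The span of the part `Σ₁` of `Σ`, that is of the elements `[… x₀ x₁]_a e₀ [x₁ x₀ …]_b` with
`a, b ≤ 2n`. Under the defining relations it is the two-sided ideal generated by `e₀`. -/
def twoSidedCell (R : Type*) {A : Type*} [CommRing R] [Ring A] [Algebra R A] (n : ℕ)
    (x e : Fin 2 → A) : Submodule R A :=
  Submodule.span R (Set.range (sigmaOf n x e ∘ Sum.inr))

theorem altTo_mul_e_mem_leftCell {n a : ℕ} {x e : Fin 2 → A} (ha : a ≤ 2 * n) :
    altTo (x 0) (x 1) a * e 0 ∈ leftCell R n x e :=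
  Submodule.subset_span ⟨⟨a, by omega⟩, rfl⟩

theorem e_zero_mem_leftCell (n : ℕ) (x e : Fin 2 → A) : e 0 ∈ leftCell R n x e := by
  simpa [altTo] using altTo_mul_e_mem_leftCell (R := R) (x := x) (e := e) (zero_le (a := 2 * n))

theorem e_zero_mem_twoSidedCell (n : ℕ) (x e : Fin 2 → A) : e 0 ∈ twoSidedCell R n x e :=
  Submodule.subset_span ⟨(0, 0), by simp [sigmaOf, altTo, altFrom]⟩

theorem mul_mem_twoSidedCell {n : ℕ} {x e : Fin 2 → A} {t : A}
    (ht : ∀ z ∈ leftCell R n x e, t * z ∈ leftCell R n x e) {z : A}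
    (hz : z ∈ twoSidedCell R n x e) : t * z ∈ twoSidedCell R n x e := by
  have mul_altFrom_mem (b : Fin (2 * n + 1)) : leftCell R n x e ≤
      (twoSidedCell R n x e).comap (LinearMap.mulRight R (altFrom (x 1) (x 0) b)) := by
    refine Submodule.span_le.2 ?_
    rintro _ ⟨a, rfl⟩
    exact Submodule.subset_span ⟨(a, b), rfl⟩
  refine mul_mem_of_mem_span ?_ hz
  rintro _ ⟨⟨a, b⟩, rfl⟩
  simpa [sigmaOf, mul_assoc] using
    mul_altFrom_mem b (ht _ (altTo_mul_e_mem_leftCell (Nat.lt_succ_iff.1 a.2)))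

theorem op_mem_twoSidedCell {n : ℕ} {x e : Fin 2 → A} {z : A} :
    MulOpposite.op z ∈ twoSidedCell R n (fun i => MulOpposite.op (x i))
      (fun i => MulOpposite.op (e i)) ↔ z ∈ twoSidedCell R n x e := by
  have op_sigmaOf (p : Fin (2 * n + 1) × Fin (2 * n + 1)) :
      sigmaOf n (fun i => MulOpposite.op (x i)) (fun i => MulOpposite.op (e i)) (Sum.inr p) =
        MulOpposite.op (sigmaOf n x e (Sum.inr p.swap)) := by
    simp [sigmaOf, op_altFrom, op_altTo, mul_assoc]
  have map_op : twoSidedCell R n (fun i => MulOpposite.op (x i)) (fun i => MulOpposite.op (e i)) =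
      (twoSidedCell R n x e).map (MulOpposite.opLinearEquiv R : A ≃ₗ[R] Aᵐᵒᵖ).toLinearMap := by
    rw [twoSidedCell, twoSidedCell, Submodule.map_span, ← Set.range_comp,
      ← Prod.swap_surjective.range_comp (_ ∘ sigmaOf n x e ∘ Sum.inr)]
    exact congrArg (fun f => Submodule.span R (Set.range f)) (funext op_sigmaOf)
  rw [map_op]
  exact (MulOpposite.op_injective (α := A)).mem_set_image

namespace Satisfies

variable {m : R} {l : Rˣ} {τ : R} {n : ℕ} {x y e : Fin 2 → A}

theorem y_eq (h : Satisfies m l τ n x y e) (i : Fin 2) : y i = x i - m • e i + m • 1 := by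
  have skein := h.skein i
  rw [sub_eq_iff_eq_add, smul_sub] at skein
  rw [skein]
  abel

theorem x_mul_x_mul (h : Satisfies m l τ n x y e) (i : Fin 2) (z : A) :
    x i * (x i * z) = z - m • (x i * z) + (m * l) • (e i * z) := by
  have x_mul_x : x i * x i = 1 - m • x i + (m * l) • e i := by
    have x_mul_y := h.x_mul_y i
    rw [h.y_eq, mul_add, mul_sub, mul_smul_comm, mul_smul_comm, h.x_mul_e, mul_one, smul_smul]
      at x_mul_y
    rw [← x_mul_y]
    abel
  rw [← mul_assoc, x_mul_x, add_mul, sub_mul, one_mul, smul_mul_assoc, smul_mul_assoc]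

theorem y_mul_e (h : Satisfies m l τ n x y e) (i : Fin 2) :
    y i * e i = ((l⁻¹ : Rˣ) : R) • e i := by
  calc y i * e i = ((l⁻¹ : Rˣ) : R) • (y i * ((l : R) • e i)) := by
        rw [mul_smul_comm, smul_smul, Units.inv_mul, one_smul]
    _ = ((l⁻¹ : Rˣ) : R) • e i := by rw [← h.x_mul_e, ← mul_assoc, h.y_mul_x, one_mul]

theorem e_one_eq (h : Satisfies m l τ n x y e) :
    e 1 = altFrom (x 0) (x 1) (2 * n) * e 0 * altFrom (y 1) (y 0) (2 * n) := by
  rw [show altFrom (x 0) (x 1) (2 * n) * e 0 = e 1 * altFrom (x 0) (x 1) (2 * n) from h.slide 0,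
    mul_assoc, ← altTo_even_eq, altTo_mul_altFrom (h.x_mul_y 0) (h.x_mul_y 1), mul_one]

theorem braid_rev (h : Satisfies m l τ n x y e) (i : Fin 2) :
    altFrom (x i.rev) (x i) (2 * n + 1) = altFrom (x i) (x i.rev) (2 * n + 1) := by
  fin_cases i
  exacts [h.braid.symm, h.braid]

theorem x_mul_x_mul_mem (h : Satisfies m l τ n x y e) {i : Fin 2} {S : Submodule R A} {z : A}
    (hz : z ∈ S) (hx : x i * z ∈ S) (he : e i * z ∈ S) : x i * (x i * z) ∈ S := by
  rw [h.x_mul_x_mul]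
  exact S.add_mem (S.sub_mem hz (S.smul_mem _ hx)) (S.smul_mem _ he)

theorem y_mul_mem (h : Satisfies m l τ n x y e) {i : Fin 2} {S : Submodule R A} {z : A}
    (hz : z ∈ S) (hx : x i * z ∈ S) (he : e i * z ∈ S) : y i * z ∈ S := by
  rw [h.y_eq, add_mul, sub_mul, smul_mul_assoc, smul_mul_assoc, one_mul]
  exact S.add_mem (S.sub_mem hx (S.smul_mem _ he)) (S.smul_mem _ hz)

theorem exists_e_zero_mul_altTo (h : Satisfies m l τ n x y e) {a : ℕ} (ha : a ≤ 2 * n) :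
    ∃ c : R, e 0 * (altTo (x 0) (x 1) a * e 0) = c • e 0 := by
  have odd {k : ℕ} (hk : k < n) :
      e 0 * altFrom (x 1) (x 0) (2 * k + 1) * e 0 = ((l⁻¹ : Rˣ) : R) • e 0 := h.e_x_e 0 k hk
  obtain ⟨k, rfl | rfl⟩ := Nat.even_or_odd' a
  · rcases k with _ | k
    · exact ⟨τ, by simpa [altTo] using h.e_mul_e 0⟩
    · refine ⟨l * ((l⁻¹ : Rˣ) : R), ?_⟩
      rw [mul_add_one, altTo_even, altTo_odd_eq, mul_assoc (x 0), ← mul_assoc, h.e_mul_x,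
        smul_mul_assoc, ← mul_assoc, odd (by omega), smul_smul]
  · exact ⟨((l⁻¹ : Rˣ) : R), by rw [altTo_odd_eq, ← mul_assoc, odd (by omega)]⟩

theorem exists_e_zero_mul_altFrom_y (h : Satisfies m l τ n x y e) {k : ℕ} (hk : k ≤ n) :
    ∃ c : R, e 0 * (altFrom (y 1) (y 0) (2 * k) * e 0) = c • e 0 := by
  rcases k with _ | k
  · exact ⟨τ, by simpa [altFrom] using h.e_mul_e 0⟩
  · have odd : e 0 * altFrom (y 1) (y 0) (2 * k + 1) * e 0 = (l : R) • e 0 := h.e_y_e 0 k hk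
    refine ⟨((l⁻¹ : Rˣ) : R) * l, ?_⟩
    rw [mul_add_one, altFrom_even, mul_assoc _ (y 0), h.y_mul_e, mul_smul_comm, mul_smul_comm,
      ← mul_assoc, odd, smul_smul]

-- Writing `e₁` as a conjugate of `e₀`, the word in `y` cancels most of the word in `x`.
theorem exists_e_one_mul_altTo (h : Satisfies m l τ n x y e) {k : ℕ} (hk : k ≤ n) :
    ∃ c : R, e 1 * (altTo (x 0) (x 1) (2 * k) * e 0) = c • (altTo (x 0) (x 1) (2 * n) * e 0) := by
  obtain ⟨j, rfl⟩ := Nat.exists_eq_add_of_le' hk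
  obtain ⟨c, hc⟩ := h.exists_e_zero_mul_altFrom_y (Nat.le_add_right j k)
  refine ⟨c, ?_⟩
  rw [h.e_one_eq, altTo_even_eq, altTo_even_eq, mul_assoc,
    ← mul_assoc _ (altFrom (x 0) (x 1) (2 * k)),
    altFrom_add_mul_altFrom (h.y_mul_x 0) (h.y_mul_x 1), mul_assoc, hc, mul_smul_comm]

theorem e_mul_mem_leftCell (h : Satisfies m l τ n x y e) (i : Fin 2) {z : A}
    (hz : z ∈ leftCell R n x e) : e i * z ∈ leftCell R n x e := by
  refine mul_mem_of_mem_span ?_ hz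
  rintro _ ⟨⟨a, ha⟩, rfl⟩
  revert i
  refine Fin.forall_fin_two.2 ⟨?_, ?_⟩
  · obtain ⟨c, hc⟩ := h.exists_e_zero_mul_altTo (Nat.lt_succ_iff.1 ha)
    rw [hc]
    exact Submodule.smul_mem _ _ (e_zero_mem_leftCell n x e)
  · obtain ⟨k, rfl | rfl⟩ := Nat.even_or_odd' a <;>
      obtain ⟨c, hc⟩ := h.exists_e_one_mul_altTo (k := k) (by omega)
    · rw [hc]
      exact Submodule.smul_mem _ _ (altTo_mul_e_mem_leftCell le_rfl)
    · simp only [altTo_odd, mul_assoc (x 1)]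
      rw [← mul_assoc, h.e_mul_x, smul_mul_assoc, hc]
      exact Submodule.smul_mem _ _ (Submodule.smul_mem _ _ (altTo_mul_e_mem_leftCell le_rfl))

theorem x_mul_mem_leftCell (h : Satisfies m l τ n x y e) (i : Fin 2) {z : A}
    (hz : z ∈ leftCell R n x e) : x i * z ∈ leftCell R n x e := by
  have slide : altFrom (x 0) (x 1) (2 * n) * e 0 = e 1 * altFrom (x 0) (x 1) (2 * n) := h.slide 0
  refine mul_mem_of_mem_span ?_ hz
  rintro _ ⟨⟨a, ha⟩, rfl⟩
  have mem {b : ℕ} (hb : b ≤ a) : altTo (x 0) (x 1) b * e 0 ∈ leftCell R n x e :=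
    altTo_mul_e_mem_leftCell (by omega)
  revert i
  refine Fin.forall_fin_two.2 ⟨?_, ?_⟩ <;> obtain ⟨k, rfl | rfl⟩ := Nat.even_or_odd' a
  · rcases k with _ | k
    · simpa [altTo, h.x_mul_e] using Submodule.smul_mem _ (l : R) (e_zero_mem_leftCell n x e)
    · have succ_mem := mem le_rfl
      simp only [mul_add_one, altTo_even, mul_assoc (x 0)] at succ_mem ⊢
      exact h.x_mul_x_mul_mem (mem (by omega)) succ_mem
        (h.e_mul_mem_leftCell 0 (mem (by omega)))
  · rw [← mul_assoc, ← altTo_even]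
    exact altTo_mul_e_mem_leftCell (by omega)
  · rcases Nat.lt_or_ge k n with hk | hk
    · rw [← mul_assoc, ← altTo_odd]
      exact altTo_mul_e_mem_leftCell (by omega)
    · obtain rfl : k = n := by omega
      simp only [altTo_even_eq]
      rw [slide, ← mul_assoc, h.x_mul_e, smul_mul_assoc, ← slide, ← altTo_even_eq]
      exact Submodule.smul_mem _ _ (mem le_rfl)
  · have odd_mem := mem le_rfl
    simp only [altTo_odd, mul_assoc (x 1)] at odd_mem ⊢
    exact h.x_mul_x_mul_mem (mem (by omega)) odd_mem (h.e_mul_mem_leftCell 1 (mem (by omega)))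

theorem e_mul_mem_twoSidedCell (h : Satisfies m l τ n x y e) (i : Fin 2) {z : A}
    (hz : z ∈ twoSidedCell R n x e) : e i * z ∈ twoSidedCell R n x e :=
  mul_mem_twoSidedCell (fun _ => h.e_mul_mem_leftCell i) hz

theorem x_mul_mem_twoSidedCell (h : Satisfies m l τ n x y e) (i : Fin 2) {z : A}
    (hz : z ∈ twoSidedCell R n x e) : x i * z ∈ twoSidedCell R n x e :=
  mul_mem_twoSidedCell (fun _ => h.x_mul_mem_leftCell i) hz

theorem mul_x_mem_twoSidedCell (h : Satisfies m l τ n x y e) (i : Fin 2) {z : A}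
    (hz : z ∈ twoSidedCell R n x e) : z * x i ∈ twoSidedCell R n x e := by
  rw [← op_mem_twoSidedCell] at hz ⊢
  exact h.op.x_mul_mem_twoSidedCell i hz

theorem mul_y_mem_twoSidedCell (h : Satisfies m l τ n x y e) (i : Fin 2) {z : A}
    (hz : z ∈ twoSidedCell R n x e) : z * y i ∈ twoSidedCell R n x e := by
  rw [← op_mem_twoSidedCell] at hz ⊢
  exact h.op.y_mul_mem hz (h.op.x_mul_mem_twoSidedCell i hz) (h.op.e_mul_mem_twoSidedCell i hz)

theorem e_mem_twoSidedCell (h : Satisfies m l τ n x y e) (i : Fin 2) :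
    e i ∈ twoSidedCell R n x e := by
  revert i
  refine Fin.forall_fin_two.2 ⟨e_zero_mem_twoSidedCell n x e, ?_⟩
  have slide : altFrom (x 0) (x 1) (2 * n) * e 0 ∈ twoSidedCell R n x e :=
    Submodule.subset_span ⟨(Fin.last _, 0), by simp [sigmaOf, altTo_even_eq, altFrom]⟩
  rw [h.e_one_eq]
  exact mul_altFrom_mem (fun _ => h.mul_y_mem_twoSidedCell 1)
    (fun _ => h.mul_y_mem_twoSidedCell 0) _ slide

theorem e_mul_altFrom_mem_twoSidedCell (h : Satisfies m l τ n x y e) (i j : Fin 2) (k : ℕ) :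
    e i * altFrom (x j) (x j.rev) k ∈ twoSidedCell R n x e :=
  mul_altFrom_mem (fun _ => h.mul_x_mem_twoSidedCell j)
    (fun _ => h.mul_x_mem_twoSidedCell j.rev) k (h.e_mem_twoSidedCell i)

end Satisfies

theorem twoSidedCell_le_span_sigmaOf (n : ℕ) (x e : Fin 2 → A) :
    twoSidedCell R n x e ≤ Submodule.span R (Set.range (sigmaOf n x e)) :=
  Submodule.span_mono (Set.range_comp_subset_range _ _)

theorem mul_mem_of_mem_span_sigmaOf {n : ℕ} {x e : Fin 2 → A} {S : Submodule R A} {t : A}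
    (hword : ∀ (j : Fin 2), ∀ k ≤ 2 * n + 1, t * altFrom (x j) (x j.rev) k ∈ S)
    (hcell : ∀ z ∈ twoSidedCell R n x e, t * z ∈ S) {z : A}
    (hz : z ∈ Submodule.span R (Set.range (sigmaOf n x e))) : t * z ∈ S := by
  refine mul_mem_of_mem_span ?_ hz
  rintro _ ⟨(i | j) | p, rfl⟩
  · exact hword 1 i (by omega)
  · exact hword 0 (j + 1) (by omega)
  · exact hcell _ (Submodule.subset_span ⟨p, rfl⟩)

namespace Satisfies

variable {m : R} {l : Rˣ} {τ : R} {n : ℕ} {x y e : Fin 2 → A}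

theorem altFrom_mem_span_sigmaOf (h : Satisfies m l τ n x y e) (i : Fin 2) {k : ℕ}
    (hk : k ≤ 2 * n + 1) :
    altFrom (x i) (x i.rev) k ∈ Submodule.span R (Set.range (sigmaOf n x e)) := by
  have from_one {k : ℕ} (hk : k ≤ 2 * n) :
      altFrom (x 1) (x 0) k ∈ Submodule.span R (Set.range (sigmaOf n x e)) :=
    Submodule.subset_span ⟨Sum.inl (Sum.inl ⟨k, by omega⟩), rfl⟩
  have from_zero {k : ℕ} (hk : k ≤ 2 * n) :
      altFrom (x 0) (x 1) (k + 1) ∈ Submodule.span R (Set.range (sigmaOf n x e)) :=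
    Submodule.subset_span ⟨Sum.inl (Sum.inr ⟨k, by omega⟩), rfl⟩
  revert i
  refine Fin.forall_fin_two.2 ⟨?_, ?_⟩
  · rcases k with _ | k
    · exact from_one zero_le
    · exact from_zero (Nat.le_of_succ_le_succ hk)
  · rcases hk.lt_or_eq with hk | rfl
    · exact from_one (Nat.le_of_lt_succ hk)
    · exact h.braid_rev 0 ▸ from_zero le_rfl

theorem e_mul_mem_span_sigmaOf (h : Satisfies m l τ n x y e) (i : Fin 2) {z : A}
    (hz : z ∈ Submodule.span R (Set.range (sigmaOf n x e))) :
    e i * z ∈ Submodule.span R (Set.range (sigmaOf n x e)) :=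
  mul_mem_of_mem_span_sigmaOf
    (fun j k _ => twoSidedCell_le_span_sigmaOf n x e (h.e_mul_altFrom_mem_twoSidedCell i j k))
    (fun _ hz => twoSidedCell_le_span_sigmaOf n x e (h.e_mul_mem_twoSidedCell i hz)) hz

theorem x_mul_mem_span_sigmaOf (h : Satisfies m l τ n x y e) (i : Fin 2) {z : A}
    (hz : z ∈ Submodule.span R (Set.range (sigmaOf n x e))) :
    x i * z ∈ Submodule.span R (Set.range (sigmaOf n x e)) := by
  have x_mul_self_word {k : ℕ} (hk : k ≤ 2 * n + 1) :
      x i * altFrom (x i) (x i.rev) k ∈ Submodule.span R (Set.range (sigmaOf n x e)) := by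
    rcases k with _ | k
    · exact h.altFrom_mem_span_sigmaOf i (by omega : 1 ≤ 2 * n + 1)
    · have word_mem := h.altFrom_mem_span_sigmaOf i.rev (by omega : k ≤ 2 * n + 1)
      rw [Fin.rev_rev] at word_mem
      exact h.x_mul_x_mul_mem word_mem (h.altFrom_mem_span_sigmaOf i hk)
        (h.e_mul_mem_span_sigmaOf i word_mem)
  refine mul_mem_of_mem_span_sigmaOf (fun j k hk => ?_)
    (fun _ hz => twoSidedCell_le_span_sigmaOf n x e (h.x_mul_mem_twoSidedCell i hz)) hz
  obtain rfl | rfl := eq_or_eq_rev i j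
  · exact x_mul_self_word hk
  · rw [Fin.rev_rev]
    rcases hk.lt_or_eq with hk | rfl
    · exact h.altFrom_mem_span_sigmaOf i (k := k + 1) hk
    · rw [h.braid_rev]
      exact x_mul_self_word le_rfl

end Satisfies

theorem adjoin_range_gen (m : R) (l : Rˣ) (τ : R) (n : ℕ) :
    Algebra.adjoin R (Set.range (gen m l τ n)) = ⊤ := by
  have surjective := RingQuot.mkAlgHom_surjective R (Rel R m l τ n)
  rw [← (AlgHom.range_eq_top _).2 surjective, ← Algebra.map_top, ← FreeAlgebra.adjoin_range_ι,
    AlgHom.map_adjoin, ← Set.range_comp]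
  rfl

/-- The family `Σ` of `BMW R m l τ n`. -/
def sigmaGen (m : R) (l : Rˣ) (τ : R) (n : ℕ) : SigmaIdx n → BMW R m l τ n :=
  sigmaOf n (gen m l τ n ∘ Gen.X) (gen m l τ n ∘ Gen.E)

theorem gen_mul_mem_span_sigmaGen (m : R) (l : Rˣ) (τ : R) (n : ℕ) (g : Gen) {z : BMW R m l τ n}
    (hz : z ∈ Submodule.span R (Set.range (sigmaGen m l τ n))) :
    gen m l τ n g * z ∈ Submodule.span R (Set.range (sigmaGen m l τ n)) := by
  have h := satisfies_gen m l τ n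
  cases g with
  | X i => exact h.x_mul_mem_span_sigmaOf i hz
  | Xinv i => exact h.y_mul_mem hz (h.x_mul_mem_span_sigmaOf i hz) (h.e_mul_mem_span_sigmaOf i hz)
  | E i => exact h.e_mul_mem_span_sigmaOf i hz

theorem span_sigmaGen (m : R) (l : Rˣ) (τ : R) (n : ℕ) :
    Submodule.span R (Set.range (sigmaGen m l τ n)) = ⊤ := by
  set S := Submodule.span R (Set.range (sigmaGen m l τ n))
  have mul_mem (t : BMW R m l τ n) : ∀ z ∈ S, t * z ∈ S := by
    have ht : t ∈ Algebra.adjoin R (Set.range (gen m l τ n)) :=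
      adjoin_range_gen m l τ n ▸ Algebra.mem_top
    induction ht using Algebra.adjoin_induction with
    | mem t ht =>
      obtain ⟨g, rfl⟩ := ht
      exact fun z hz => gen_mul_mem_span_sigmaGen m l τ n g hz
    | algebraMap r =>
      intro z hz
      rw [← Algebra.smul_def]
      exact S.smul_mem r hz
    | add s t _ _ hs ht =>
      intro z hz
      rw [add_mul]
      exact S.add_mem (hs z hz) (ht z hz)
    | mul s t _ _ hs ht =>
      intro z hz
      rw [mul_assoc]
      exact hs _ (ht z hz)
  have one_mem : 1 ∈ S := Submodule.subset_span ⟨Sum.inl (Sum.inl 0), rfl⟩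
  exact eq_top_iff.2 fun z _ => mul_one z ▸ mul_mem z 1 one_mem

end Spanning

section Braid

variable {R A : Type*} [CommRing R] [Ring A] [Algebra R A] {n : ℕ}

theorem braid_defect_mul {c d : R} {x e : Fin 2 → A}
    (x_sq : ∀ i, x i * x i = 1 - c • x i + d • e i)
    (slide : ∀ i, altFrom (x i) (x i.rev) (2 * n) * e i =
      e i.rev * altFrom (x i) (x i.rev) (2 * n)) (i : Fin 2) :
    (altFrom (x i) (x i.rev) (2 * n + 1) - altFrom (x i.rev) (x i) (2 * n + 1)) * x i.rev =
      -(x i + c • 1) *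
        (altFrom (x i) (x i.rev) (2 * n + 1) - altFrom (x i.rev) (x i) (2 * n + 1)) := by
  have slide_rev := slide i.rev
  rw [Fin.rev_rev] at slide_rev
  have word_mul : altFrom (x i) (x i.rev) (2 * n + 1) * x i.rev =
      x i * altFrom (x i.rev) (x i) (2 * n + 1) := by
    rw [← altFrom_even, ← altFrom_succ]
  have rev_word_mul : altFrom (x i.rev) (x i) (2 * n + 1) * x i.rev =
      altFrom (x i.rev) (x i) (2 * n) - c • altFrom (x i.rev) (x i) (2 * n + 1)
        + d • (altFrom (x i.rev) (x i) (2 * n) * e i.rev) := by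
    rw [altFrom_odd, mul_assoc, x_sq, mul_add, mul_sub, mul_one, mul_smul_comm, mul_smul_comm]
  have mul_word : x i * altFrom (x i) (x i.rev) (2 * n + 1) =
      altFrom (x i.rev) (x i) (2 * n) - c • altFrom (x i) (x i.rev) (2 * n + 1)
        + d • (e i * altFrom (x i.rev) (x i) (2 * n)) := by
    rw [altFrom_succ, ← mul_assoc, x_sq, add_mul, sub_mul, one_mul, smul_mul_assoc,
      smul_mul_assoc]
  rw [sub_mul, word_mul, rev_word_mul, neg_mul, add_mul, mul_sub, mul_word, smul_mul_assoc,
    one_mul, slide_rev, smul_sub]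
  abel

-- The kernel of the difference of the two words is stable under both operators.
theorem braid_of_apply_eq {c d : R} {V : Type*} [AddCommGroup V] [Module R V]
    {x e : Fin 2 → Module.End R V} (x_sq : ∀ i, x i * x i = 1 - c • x i + d • e i)
    (slide : ∀ i, altFrom (x i) (x i.rev) (2 * n) * e i =
      e i.rev * altFrom (x i) (x i.rev) (2 * n))
    (v : V) (hv : altFrom (x 0) (x 1) (2 * n + 1) v = altFrom (x 1) (x 0) (2 * n + 1) v)
    (hgen : ∀ p : Submodule R V, v ∈ p → (∀ i, ∀ w ∈ p, x i w ∈ p) → p = ⊤) :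
    altFrom (x 0) (x 1) (2 * n + 1) = altFrom (x 1) (x 0) (2 * n + 1) := by
  set D : Fin 2 → Module.End R V := fun i =>
    altFrom (x i) (x i.rev) (2 * n + 1) - altFrom (x i.rev) (x i) (2 * n + 1) with hD
  have D_rev (i : Fin 2) : D i.rev = -D i := by simp [hD]
  have D_mul_x (i : Fin 2) : D i * x i.rev = -(x i + c • 1) * D i :=
    braid_defect_mul x_sq slide i
  have D_x_rev {i : Fin 2} {w : V} (hw : D i w = 0) : D i (x i.rev w) = 0 := by
    rw [← Module.End.mul_apply, D_mul_x, Module.End.mul_apply, hw, map_zero]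
  rw [← sub_eq_zero]
  change D 0 = 0
  refine LinearMap.ker_eq_top.1 (hgen _ (by simp [hD, hv]) ?_)
  simp only [LinearMap.mem_ker]
  refine Fin.forall_fin_two.2 ⟨fun w hw => ?_, fun w => D_x_rev⟩
  have D_one : D 1 = -D 0 := D_rev 0
  have hw' : D 1 w = 0 := by rw [D_one, LinearMap.neg_apply, hw, neg_zero]
  have := D_x_rev hw'
  rwa [D_one, LinearMap.neg_apply, neg_eq_zero] at this

theorem semiconjBy_of_mul_eq_one {A : Type*} [Monoid A] {d x y x' y' : A}
    (h : SemiconjBy d x x') (hx : x * y = 1) (hx' : y' * x' = 1) : SemiconjBy d y y' := by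
  calc d * y = y' * (x' * d) * y := by rw [← mul_assoc, hx', one_mul]
    _ = y' * d := by rw [← h.eq, mul_assoc, mul_assoc, hx, mul_one]

theorem mul_mul_eq_smul_of_semiconjBy {c : R} {d e e' w w' : A} (hd : IsUnit d)
    (he : SemiconjBy d e e') (hw : SemiconjBy d w w') (h : e * w * e = c • e) :
    e' * w' * e' = c • e' := by
  refine hd.mul_right_cancel ?_
  rw [← ((he.mul_right hw).mul_right he).eq, h, mul_smul_comm, he.eq, smul_mul_assoc]

-- Conjugation by the word in the braid relation exchanges the two indices.
theorem Satisfies.of_zero {m : R} {l : Rˣ} {τ : R} {x y e : Fin 2 → A}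
    (x_mul_y : ∀ i, x i * y i = 1) (y_mul_x : ∀ i, y i * x i = 1)
    (braid : altFrom (x 0) (x 1) (2 * n + 1) = altFrom (x 1) (x 0) (2 * n + 1))
    (skein : ∀ i, x i - y i = m • (e i - 1))
    (x_mul_e : ∀ i, x i * e i = (l : R) • e i) (e_mul_x : ∀ i, e i * x i = (l : R) • e i)
    (e_mul_e : ∀ i, e i * e i = τ • e i)
    (e_x_e_zero : ∀ k < n,
      e 0 * altFrom (x 1) (x 0) (2 * k + 1) * e 0 = ((l⁻¹ : Rˣ) : R) • e 0)
    (e_y_e_zero : ∀ k < n, e 0 * altFrom (y 1) (y 0) (2 * k + 1) * e 0 = (l : R) • e 0)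
    (slide : ∀ i, altFrom (x i) (x i.rev) (2 * n) * e i =
      e i.rev * altFrom (x i) (x i.rev) (2 * n)) :
    Satisfies m l τ n x y e := by
  set d := altFrom (x 0) (x 1) (2 * n + 1) with hd
  have isUnit_x (i : Fin 2) : IsUnit (x i) := ⟨⟨x i, y i, x_mul_y i, y_mul_x i⟩, rfl⟩
  have isUnit_d : IsUnit d := isUnit_altFrom (isUnit_x 0) (isUnit_x 1) _
  have d_x_zero : SemiconjBy d (x 0) (x 1) := by
    rw [SemiconjBy, braid, ← altFrom_even, altFrom_succ, ← braid]
  have d_x_one : SemiconjBy d (x 1) (x 0) := by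
    rw [SemiconjBy, hd, ← altFrom_even, altFrom_succ, ← braid]
  have d_y_zero : SemiconjBy d (y 0) (y 1) :=
    semiconjBy_of_mul_eq_one d_x_zero (x_mul_y 0) (y_mul_x 1)
  have d_y_one : SemiconjBy d (y 1) (y 0) :=
    semiconjBy_of_mul_eq_one d_x_one (x_mul_y 1) (y_mul_x 0)
  have d_e_zero : SemiconjBy d (e 0) (e 1) := by
    have slide_zero : altFrom (x 0) (x 1) (2 * n) * e 0 = e 1 * altFrom (x 0) (x 1) (2 * n) :=
      slide 0
    rw [SemiconjBy, hd, altFrom_odd, mul_assoc, x_mul_e, ← mul_assoc, ← slide_zero, mul_assoc,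
      e_mul_x]
  exact ⟨x_mul_y, y_mul_x, braid, skein, x_mul_e, e_mul_x, e_mul_e,
    Fin.forall_fin_two.2 ⟨e_x_e_zero, fun k hk => mul_mul_eq_smul_of_semiconjBy isUnit_d d_e_zero
      (semiconjBy_altFrom d_x_one d_x_zero _) (e_x_e_zero k hk)⟩,
    Fin.forall_fin_two.2 ⟨e_y_e_zero, fun k hk => mul_mul_eq_smul_of_semiconjBy isUnit_d d_e_zero
      (semiconjBy_altFrom d_y_one d_y_zero _) (e_y_e_zero k hk)⟩, slide⟩

end Braid

section Chain

/-- Two operators act on the vectors `v 0, …, v (2n)` as `x₀`, `x₁` act on the elements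
`[… x₀ x₁]_a e₀` of an algebra satisfying the defining relations. -/
structure IsChain {K V : Type*} [CommRing K] [AddCommGroup V] [Module K V] (m l : K) (n : ℕ)
    (x₀ x₁ : Module.End K V) (v : ℕ → V) : Prop where
  zero : x₀ (v 0) = l • v 0
  up₀ (k : ℕ) (hk : k < n) : x₀ (v (2 * k + 1)) = v (2 * k + 2)
  down₀ (k : ℕ) (hk : k < n) :
    x₀ (v (2 * k + 2)) = v (2 * k + 1) + m • v 0 - m • v (2 * k + 2)
  top : x₁ (v (2 * n)) = l • v (2 * n)
  up₁ (k : ℕ) (hk : k < n) : x₁ (v (2 * k)) = v (2 * k + 1)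
  down₁ (k : ℕ) (hk : k < n) :
    x₁ (v (2 * k + 1)) = v (2 * k) + (m * l) • v (2 * n) - m • v (2 * k + 1)

namespace IsChain

variable {K V : Type*} [CommRing K] [AddCommGroup V] [Module K V] {m l : K} {n : ℕ}
  {x₀ x₁ : Module.End K V} {v : ℕ → V}

theorem altTo_zero (h : IsChain m l n x₀ x₁ v) {a : ℕ} (ha : a ≤ 2 * n) :
    altTo x₀ x₁ a (v 0) = v a := by
  induction a with
  | zero => simp [altTo]
  | succ a ih =>
    obtain ⟨k, rfl | rfl⟩ := Nat.even_or_odd' a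
    · rw [altTo_odd, Module.End.mul_apply, ih (by omega), h.up₁ k (by omega)]
    · rw [altTo_even, Module.End.mul_apply, ih (by omega), h.up₀ k (by omega)]

theorem x₀_sum_odd (h : IsChain m l n x₀ x₁ v) {k : ℕ} (hk : k ≤ n) :
    x₀ (∑ i ∈ Finset.range k, v (2 * i + 1)) =
      ∑ i ∈ Finset.range (k + 1), v (2 * i) - v 0 := by
  rw [map_sum, Finset.sum_range_succ', mul_zero, add_sub_cancel_right]
  refine Finset.sum_congr rfl fun i hi => h.up₀ i ?_
  exact (Finset.mem_range.1 hi).trans_le hk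

theorem x₁_sum_even (h : IsChain m l n x₀ x₁ v) {k : ℕ} (hk : k ≤ n) :
    x₁ (∑ i ∈ Finset.range k, v (2 * i)) = ∑ i ∈ Finset.range k, v (2 * i + 1) := by
  rw [map_sum]
  refine Finset.sum_congr rfl fun i hi => h.up₁ i ?_
  exact (Finset.mem_range.1 hi).trans_le hk

theorem altTo_top (h : IsChain m l n x₀ x₁ v) (k j : ℕ) (hkj : k + j = n) :
    altTo x₁ x₀ (2 * k) (v (2 * n)) = v (2 * j) + m •
      (∑ i ∈ Finset.range k, v (2 * i + 1) + ∑ i ∈ Finset.range j, v (2 * i + 1)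
        - ∑ i ∈ Finset.range n, v (2 * i + 1)) := by
  induction k generalizing j with
  | zero =>
    obtain rfl : j = n := by omega
    simp [altTo]
  | succ k ih =>
    have x₀_apply : x₀ (altTo x₁ x₀ (2 * k) (v (2 * n))) = v (2 * j + 1) + m •
        (∑ i ∈ Finset.range (k + 1), v (2 * i) + ∑ i ∈ Finset.range (j + 1), v (2 * i)
          - ∑ i ∈ Finset.range (n + 1), v (2 * i)) := by
      rw [ih (j + 1) (by omega), map_add, map_smul, map_sub, map_add, mul_add_one,
        h.down₀ j (by omega), h.x₀_sum_odd (by omega), h.x₀_sum_odd (by omega),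
        h.x₀_sum_odd le_rfl, Finset.sum_range_succ _ (j + 1), mul_add_one]
      module
    rw [mul_add_one, altTo_even, altTo_odd, Module.End.mul_apply, Module.End.mul_apply, x₀_apply,
      map_add, map_smul, map_sub, map_add, h.down₁ j (by omega), h.x₁_sum_even (by omega),
      h.x₁_sum_even (by omega), Finset.sum_range_succ _ n, map_add, h.x₁_sum_even le_rfl, h.top,
      Finset.sum_range_succ _ j]
    module

theorem altFrom_top (h : IsChain m l n x₀ x₁ v) : altFrom x₁ x₀ (2 * n) (v (2 * n)) = v 0 := by
  rw [← altTo_even_eq, h.altTo_top n 0 (add_zero n)]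
  simp

end IsChain

end Chain

section CellModule

variable {K W : Type*} [CommRing K] [AddCommGroup W] [Module K W]

/-- The coefficient `c` in the relation `e₀ [y₁ y₀ …]_b [… x₀ x₁]_a e₀ = c e₀`, which holds for
`a, b ≤ 2n`. -/
def gram (l : Kˣ) (τ : K) (b a : ℕ) : K :=
  if a = b then τ else if (a + b) % 2 = 0 then 1 else
    if b < a then ((l⁻¹ : Kˣ) : K) else (l : K)

section

variable {l : Kˣ} {τ : K} {a b : ℕ}

theorem gram_self (a : ℕ) : gram l τ a a = τ := if_pos rfl

theorem gram_of_even (h : a ≠ b) (hab : (a + b) % 2 = 0) : gram l τ b a = 1 := by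
  simp [gram, h, hab]

theorem gram_of_lt (h : b < a) (hab : (a + b) % 2 = 1) :
    gram l τ b a = ((l⁻¹ : Kˣ) : K) := by
  simp [gram, h, h.ne', hab]

theorem gram_of_gt (h : a < b) (hab : (a + b) % 2 = 1) : gram l τ b a = l := by
  simp [gram, h.ne, h.le, hab]

end

/-- The basis vector of the cell module that stands for `[… x₀ x₁]_a e₀`, where `a ≤ 2n`. The
index is a natural number, so that it can be shifted freely. -/
def cellVec (K : Type*) [CommRing K] (n a : ℕ) : Fin (2 * n + 1) → K :=
  Pi.single (Fin.ofNat (2 * n + 1) a) 1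

/-- The linear map out of the cell module that sends `cellVec K n a` to `w a`. -/
def cellMap (n : ℕ) (w : ℕ → W) : (Fin (2 * n + 1) → K) →ₗ[K] W :=
  (Pi.basisFun K (Fin (2 * n + 1))).constr K (fun i => w i)

theorem cellMap_cellVec {n : ℕ} (w : ℕ → W) {a : ℕ} (ha : a ≤ 2 * n) :
    cellMap n w (cellVec K n a) = w a := by
  rw [cellMap, cellVec, ← Pi.basisFun_apply, Module.Basis.constr_basis, Fin.val_ofNat,
    Nat.mod_eq_of_lt (Nat.lt_succ_of_le ha)]

theorem cellVec_val {n : ℕ} (i : Fin (2 * n + 1)) : cellVec K n i = Pi.single i 1 := by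
  rw [cellVec, Fin.ofNat_val_eq_self]

theorem cell_ext {n : ℕ} {f g : (Fin (2 * n + 1) → K) →ₗ[K] W}
    (h : ∀ a ≤ 2 * n, f (cellVec K n a) = g (cellVec K n a)) : f = g := by
  refine (Pi.basisFun K (Fin (2 * n + 1))).ext fun i => ?_
  rw [Pi.basisFun_apply, ← cellVec_val]
  exact h i (Nat.le_of_lt_succ i.2)

theorem cell_ext_zero {n : ℕ} {f g : (Fin (2 * n + 1) → K) →ₗ[K] W}
    (zero : f (cellVec K n 0) = g (cellVec K n 0))
    (odd : ∀ k < n, f (cellVec K n (2 * k + 1)) = g (cellVec K n (2 * k + 1)))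
    (even : ∀ k < n, f (cellVec K n (2 * k + 2)) = g (cellVec K n (2 * k + 2))) : f = g := by
  refine cell_ext fun a ha => ?_
  obtain ⟨k, rfl | rfl⟩ := Nat.even_or_odd' a
  · rcases k with _ | k
    · exact zero
    · exact even k (by omega)
  · exact odd k (by omega)

theorem cell_ext_top {n : ℕ} {f g : (Fin (2 * n + 1) → K) →ₗ[K] W}
    (top : f (cellVec K n (2 * n)) = g (cellVec K n (2 * n)))
    (even : ∀ k < n, f (cellVec K n (2 * k)) = g (cellVec K n (2 * k)))
    (odd : ∀ k < n, f (cellVec K n (2 * k + 1)) = g (cellVec K n (2 * k + 1))) : f = g := by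
  refine cell_ext fun a ha => ?_
  obtain ⟨k, rfl | rfl⟩ := Nat.even_or_odd' a
  · rcases Nat.lt_or_ge k n with hk | hk
    · exact even k hk
    · obtain rfl : k = n := by omega
      exact top
  · exact odd k (by omega)

/-- The index of the basis vector of the cell module that spans the image of `E_i`. -/
def eigenIdx (n : ℕ) : Fin 2 → ℕ := ![0, 2 * n]

theorem eigenIdx_le (n : ℕ) (i : Fin 2) : eigenIdx n i ≤ 2 * n := by
  fin_cases i <;> simp [eigenIdx]

variable (m : K) (l : Kˣ) (τ : K) (n : ℕ)

/-- The functional `v ↦ e₀ [y₁ y₀ …]_b v` on the cell module, in terms of the coefficient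
of `e₀`. -/
def cellForm (b : ℕ) : (Fin (2 * n + 1) → K) →ₗ[K] K :=
  cellMap n (gram l τ b)

/-- The image of `cellVec K n a` under `X_i`. -/
def cellXVec : Fin 2 → ℕ → Fin (2 * n + 1) → K :=
  ![fun a =>
      if a = 0 then (l : K) • cellVec K n 0
      else if a % 2 = 1 then cellVec K n (a + 1)
      else cellVec K n (a - 1) + m • cellVec K n 0 - m • cellVec K n a,
    fun a =>
      if a = 2 * n then (l : K) • cellVec K n (2 * n)
      else if a % 2 = 0 then cellVec K n (a + 1)
      else cellVec K n (a - 1) + (m * l) • cellVec K n (2 * n) - m • cellVec K n a]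

/-- The action of the `X_i` on the cell module. -/
def cellX (i : Fin 2) : Module.End K (Fin (2 * n + 1) → K) :=
  cellMap n (cellXVec m l n i)

/-- The action of the `E_i` on the cell module. -/
def cellE (i : Fin 2) : Module.End K (Fin (2 * n + 1) → K) :=
  (cellForm l τ n (eigenIdx n i)).smulRight (cellVec K n (eigenIdx n i))

/-- The action of the `X_i⁻¹` on the cell module, as dictated by the skein relation. -/
def cellY (i : Fin 2) : Module.End K (Fin (2 * n + 1) → K) :=
  cellX m l n i - m • (cellE l τ n i - 1)

variable {m l τ n}

theorem cellForm_cellVec (b : ℕ) {a : ℕ} (ha : a ≤ 2 * n) :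
    cellForm l τ n b (cellVec K n a) = gram l τ b a :=
  cellMap_cellVec _ ha

theorem cellE_apply (i : Fin 2) (v : Fin (2 * n + 1) → K) :
    cellE l τ n i v = cellForm l τ n (eigenIdx n i) v • cellVec K n (eigenIdx n i) := rfl

theorem cellY_apply (i : Fin 2) (v : Fin (2 * n + 1) → K) :
    cellY m l τ n i v = cellX m l n i v - m • (cellE l τ n i v - v) := rfl

theorem cellX_cellVec (i : Fin 2) {a : ℕ} (ha : a ≤ 2 * n) :
    cellX m l n i (cellVec K n a) = cellXVec m l n i a :=
  cellMap_cellVec _ ha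

theorem isChain_cellVec :
    IsChain m (l : K) n (cellX m l n 0) (cellX m l n 1) (cellVec K n) where
  zero := by
    rw [cellX_cellVec 0 (by omega), cellXVec, Matrix.cons_val_zero, if_pos rfl]
  up₀ k hk := by
    rw [cellX_cellVec 0 (by omega), cellXVec, Matrix.cons_val_zero,
      if_neg (by omega), if_pos (by omega)]
  down₀ k hk := by
    rw [cellX_cellVec 0 (by omega), cellXVec, Matrix.cons_val_zero,
      if_neg (by omega), if_neg (by omega)]
    rfl
  top := by
    rw [cellX_cellVec 1 (by omega), cellXVec, Matrix.cons_val_one,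
      Matrix.cons_val_fin_one, if_pos rfl]
  up₁ k hk := by
    rw [cellX_cellVec 1 (by omega), cellXVec, Matrix.cons_val_one,
      Matrix.cons_val_fin_one, if_neg (by omega), if_pos (by omega)]
  down₁ k hk := by
    rw [cellX_cellVec 1 (by omega), cellXVec, Matrix.cons_val_one,
      Matrix.cons_val_fin_one, if_neg (by omega), if_neg (by omega)]
    rfl

theorem cellX_eigenvector (i : Fin 2) : cellX m l n i (cellVec K n (eigenIdx n i)) =
    (l : K) • cellVec K n (eigenIdx n i) := by
  revert i
  exact Fin.forall_fin_two.2 ⟨isChain_cellVec.zero, isChain_cellVec.top⟩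

section

variable {k : ℕ} (hk : k < n)
include hk

theorem cellY_zero_odd : cellY m l τ n 0 (cellVec K n (2 * k + 1)) =
    cellVec K n (2 * k + 2) - (m * ((l⁻¹ : Kˣ) : K)) • cellVec K n 0
      + m • cellVec K n (2 * k + 1) := by
  rw [cellY_apply, isChain_cellVec.up₀ k hk, cellE_apply, cellForm_cellVec _ (by omega)]
  change _ - m • (gram l τ 0 _ • cellVec K n 0 - _) = _
  rw [gram_of_lt (by omega) (by omega)]
  module

theorem cellY_zero_even : cellY m l τ n 0 (cellVec K n (2 * k + 2)) =
    cellVec K n (2 * k + 1) := by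
  rw [cellY_apply, isChain_cellVec.down₀ k hk, cellE_apply, cellForm_cellVec _ (by omega)]
  change _ - m • (gram l τ 0 _ • cellVec K n 0 - _) = _
  rw [gram_of_even (by omega) (by omega)]
  module

theorem cellY_one_even : cellY m l τ n 1 (cellVec K n (2 * k)) =
    cellVec K n (2 * k + 1) - m • cellVec K n (2 * n) + m • cellVec K n (2 * k) := by
  rw [cellY_apply, isChain_cellVec.up₁ k hk, cellE_apply, cellForm_cellVec _ (by omega)]
  change _ - m • (gram l τ (2 * n) _ • cellVec K n (2 * n) - _) = _
  rw [gram_of_even (by omega) (by omega)]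
  module

theorem cellY_one_odd : cellY m l τ n 1 (cellVec K n (2 * k + 1)) = cellVec K n (2 * k) := by
  rw [cellY_apply, isChain_cellVec.down₁ k hk, cellE_apply, cellForm_cellVec _ (by omega)]
  change _ - m • (gram l τ (2 * n) _ • cellVec K n (2 * n) - _) = _
  rw [gram_of_gt (by omega) (by omega)]
  module

end

theorem cellX_mul_cellE (i : Fin 2) : cellX m l n i * cellE l τ n i = (l : K) • cellE l τ n i := by
  refine LinearMap.ext fun v => ?_
  rw [Module.End.mul_apply, cellE_apply, map_smul, cellX_eigenvector, LinearMap.smul_apply,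
    cellE_apply, smul_comm]

theorem cellE_mul_cellE (i : Fin 2) : cellE l τ n i * cellE l τ n i = τ • cellE l τ n i := by
  refine LinearMap.ext fun v => ?_
  rw [Module.End.mul_apply, cellE_apply, cellE_apply i v, map_smul,
    cellForm_cellVec _ (eigenIdx_le n i), gram_self, LinearMap.smul_apply, cellE_apply, smul_smul,
    smul_eq_mul, mul_comm τ]

variable (hτ : m * τ = l - ((l⁻¹ : Kˣ) : K) + m)
include hτ

theorem cellY_eigenvector (i : Fin 2) : cellY m l τ n i (cellVec K n (eigenIdx n i)) =
    ((l⁻¹ : Kˣ) : K) • cellVec K n (eigenIdx n i) := by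
  rw [cellY_apply, cellX_eigenvector, cellE_apply, cellForm_cellVec _ (eigenIdx_le n i), gram_self,
    smul_sub, smul_smul, hτ]
  module

theorem cellX_mul_cellY (i : Fin 2) : cellX m l n i * cellY m l τ n i = 1 := by
  have eigenvector (i : Fin 2) : (cellX m l n i * cellY m l τ n i) (cellVec K n (eigenIdx n i)) =
      cellVec K n (eigenIdx n i) := by
    rw [Module.End.mul_apply, cellY_eigenvector hτ, map_smul, cellX_eigenvector, smul_smul,
      Units.inv_mul, one_smul]
  revert i
  refine Fin.forall_fin_two.2
    ⟨cell_ext_zero (eigenvector 0) (fun k hk => ?_) (fun k hk => ?_),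
      cell_ext_top (eigenvector 1) (fun k hk => ?_) (fun k hk => ?_)⟩ <;>
    rw [Module.End.mul_apply, Module.End.one_apply]
  · rw [cellY_zero_odd hk, map_add, map_sub, map_smul, map_smul, isChain_cellVec.zero,
      isChain_cellVec.up₀ k hk, isChain_cellVec.down₀ k hk, smul_smul, mul_assoc, Units.inv_mul]
    module
  · rw [cellY_zero_even hk, isChain_cellVec.up₀ k hk]
  · rw [cellY_one_even hk, map_add, map_sub, map_smul, map_smul, isChain_cellVec.top,
      isChain_cellVec.up₁ k hk, isChain_cellVec.down₁ k hk]
    module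
  · rw [cellY_one_odd hk, isChain_cellVec.up₁ k hk]

theorem cellForm_even_comp_cellY_one {k : ℕ} (hk : k < n) :
    cellForm l τ n (2 * k) ∘ₗ cellY m l τ n 1 = cellForm l τ n (2 * k + 1) := by
  refine cell_ext_top ?_ (fun j hj => ?_) (fun j hj => ?_)
  · have eigenvector : cellY m l τ n 1 (cellVec K n (2 * n)) =
        ((l⁻¹ : Kˣ) : K) • cellVec K n (2 * n) :=
      cellY_eigenvector hτ 1
    rw [LinearMap.comp_apply, eigenvector, map_smul, cellForm_cellVec _ le_rfl,
      cellForm_cellVec _ le_rfl, gram_of_even (by omega) (by omega),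
      gram_of_lt (by omega) (by omega), smul_eq_mul, mul_one]
  · rw [LinearMap.comp_apply, cellY_one_even hj, map_add, map_sub, map_smul, map_smul,
      cellForm_cellVec _ le_rfl, cellForm_cellVec _ (by omega), cellForm_cellVec _ (by omega),
      cellForm_cellVec _ (by omega), gram_of_even (a := 2 * n) (by omega) (by omega)]
    rcases lt_trichotomy j k with h | rfl | h
    · rw [gram_of_gt (by omega) (by omega), gram_of_even (by omega) (by omega),
        gram_of_gt (by omega) (by omega)]
      ring
    · rw [gram_of_lt (by omega) (by omega), gram_self, gram_of_gt (by omega) (by omega),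
        smul_eq_mul, smul_eq_mul, hτ]
      ring
    · rw [gram_of_lt (by omega) (by omega), gram_of_even (by omega) (by omega),
        gram_of_lt (by omega) (by omega)]
      ring
  · rw [LinearMap.comp_apply, cellY_one_odd hj, cellForm_cellVec _ (by omega),
      cellForm_cellVec _ (by omega)]
    rcases eq_or_ne j k with rfl | h
    · rw [gram_self, gram_self]
    · rw [gram_of_even (by omega) (by omega), gram_of_even (by omega) (by omega)]

theorem cellForm_odd_comp_cellY_zero {k : ℕ} (hk : k < n) :
    cellForm l τ n (2 * k + 1) ∘ₗ cellY m l τ n 0 = cellForm l τ n (2 * k + 2) := by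
  refine cell_ext_zero ?_ (fun j hj => ?_) (fun j hj => ?_)
  · have eigenvector : cellY m l τ n 0 (cellVec K n 0) =
        ((l⁻¹ : Kˣ) : K) • cellVec K n 0 :=
      cellY_eigenvector hτ 0
    rw [LinearMap.comp_apply, eigenvector, map_smul, cellForm_cellVec _ (by omega),
      cellForm_cellVec _ (by omega), gram_of_gt (by omega) (by omega),
      gram_of_even (by omega) (by omega), smul_eq_mul, Units.inv_mul]
  · rw [LinearMap.comp_apply, cellY_zero_odd hj, map_add, map_sub, map_smul, map_smul,
      cellForm_cellVec _ (by omega), cellForm_cellVec _ (by omega), cellForm_cellVec _ (by omega),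
      cellForm_cellVec _ (by omega), gram_of_gt (a := 0) (by omega) (by omega), smul_eq_mul,
      smul_eq_mul, mul_assoc, Units.inv_mul]
    rcases lt_trichotomy j k with h | rfl | h
    · rw [gram_of_gt (by omega) (by omega), gram_of_even (by omega) (by omega),
        gram_of_gt (by omega) (by omega)]
      ring
    · rw [gram_of_lt (by omega) (by omega), gram_self, gram_of_gt (by omega) (by omega), hτ]
      ring
    · rw [gram_of_lt (by omega) (by omega), gram_of_even (by omega) (by omega),
        gram_of_lt (by omega) (by omega)]
      ring
  · rw [LinearMap.comp_apply, cellY_zero_even hj, cellForm_cellVec _ (by omega),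
      cellForm_cellVec _ (by omega)]
    rcases eq_or_ne j k with rfl | h
    · rw [gram_self, gram_self]
    · rw [gram_of_even (by omega) (by omega), gram_of_even (by omega) (by omega)]

theorem cellForm_zero_comp_altFrom_cellY {b : ℕ} (hb : b ≤ 2 * n) :
    cellForm l τ n 0 ∘ₗ altFrom (cellY m l τ n 1) (cellY m l τ n 0) b = cellForm l τ n b := by
  induction b with
  | zero => rfl
  | succ b ih =>
    obtain ⟨k, rfl | rfl⟩ := Nat.even_or_odd' b
    · rw [altFrom_odd, Module.End.mul_eq_comp, ← LinearMap.comp_assoc, ih (by omega),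
        cellForm_even_comp_cellY_one hτ (by omega)]
    · rw [altFrom_even, Module.End.mul_eq_comp, ← LinearMap.comp_assoc, ih (by omega),
        cellForm_odd_comp_cellY_zero hτ (by omega)]

theorem cellForm_comp_cellX (i : Fin 2) : cellForm l τ n (eigenIdx n i) ∘ₗ cellX m l n i =
    (l : K) • cellForm l τ n (eigenIdx n i) := by
  have eigenvector (i : Fin 2) :
      (cellForm l τ n (eigenIdx n i) ∘ₗ cellX m l n i) (cellVec K n (eigenIdx n i)) =
        ((l : K) • cellForm l τ n (eigenIdx n i)) (cellVec K n (eigenIdx n i)) := by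
    rw [LinearMap.comp_apply, cellX_eigenvector, map_smul, LinearMap.smul_apply]
  revert i
  refine Fin.forall_fin_two.2 ⟨cell_ext_zero (eigenvector 0) (fun k hk => ?_) (fun k hk => ?_),
    cell_ext_top (eigenvector 1) (fun k hk => ?_) (fun k hk => ?_)⟩
  · change cellForm l τ n 0 _ = (l : K) • cellForm l τ n 0 _
    rw [isChain_cellVec.up₀ k hk, cellForm_cellVec _ (by omega), cellForm_cellVec _ (by omega),
      gram_of_even (by omega) (by omega), gram_of_lt (by omega) (by omega), smul_eq_mul,
      Units.mul_inv]
  · change cellForm l τ n 0 _ = (l : K) • cellForm l τ n 0 _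
    rw [isChain_cellVec.down₀ k hk, map_sub, map_add, map_smul, map_smul,
      cellForm_cellVec _ (by omega), cellForm_cellVec _ (by omega), cellForm_cellVec _ (by omega),
      gram_of_lt (by omega) (by omega), gram_self, gram_of_even (by omega) (by omega), smul_eq_mul,
      smul_eq_mul, smul_eq_mul, hτ]
    ring
  · change cellForm l τ n (2 * n) _ = (l : K) • cellForm l τ n (2 * n) _
    rw [isChain_cellVec.up₁ k hk, cellForm_cellVec _ (by omega), cellForm_cellVec _ (by omega),
      gram_of_gt (by omega) (by omega), gram_of_even (by omega) (by omega), smul_eq_mul, mul_one]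
  · change cellForm l τ n (2 * n) _ = (l : K) • cellForm l τ n (2 * n) _
    rw [isChain_cellVec.down₁ k hk, map_sub, map_add, map_smul, map_smul,
      cellForm_cellVec _ (by omega), cellForm_cellVec _ (by omega), cellForm_cellVec _ (by omega),
      gram_of_even (by omega) (by omega), gram_self, gram_of_gt (by omega) (by omega), smul_eq_mul,
      smul_eq_mul, smul_eq_mul]
    linear_combination (l : K) * hτ - l.mul_inv

theorem cellE_mul_cellX (i : Fin 2) :
    cellE l τ n i * cellX m l n i = (l : K) • cellE l τ n i := by
  refine LinearMap.ext fun v => ?_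
  rw [Module.End.mul_apply, cellE_apply, ← LinearMap.comp_apply, cellForm_comp_cellX hτ,
    LinearMap.smul_apply, LinearMap.smul_apply, cellE_apply, smul_assoc]

theorem cellY_mul_cellX (i : Fin 2) : cellY m l τ n i * cellX m l n i = 1 := by
  rw [← cellX_mul_cellY hτ i, cellY, sub_mul, mul_sub, smul_mul_assoc, mul_smul_comm, sub_mul,
    mul_sub, cellX_mul_cellE, cellE_mul_cellX hτ, one_mul, mul_one]

theorem cellX_mul_cellX (i : Fin 2) :
    cellX m l n i * cellX m l n i = 1 - m • cellX m l n i + (m * l) • cellE l τ n i := by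
  rw [← cellX_mul_cellY hτ i, cellY, mul_sub, mul_smul_comm, mul_sub, cellX_mul_cellE, mul_one,
    smul_sub, smul_smul]
  abel

end CellModule

section CellModuleRelations

variable {K : Type*} [CommRing K] {m : K} {l : Kˣ} {τ : K} {n : ℕ}

theorem comp_cellX (i : Fin 2) (f : (Fin (2 * n + 1) → K) →ₗ[K] K) :
    f ∘ₗ cellX m l n i = f ∘ₗ cellY m l τ n i
      + (m * f (cellVec K n (eigenIdx n i))) • cellForm l τ n (eigenIdx n i) - m • f := by
  refine LinearMap.ext fun v => ?_
  simp only [LinearMap.comp_apply, LinearMap.add_apply, LinearMap.sub_apply,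
    LinearMap.smul_apply, cellY_apply, cellE_apply, map_sub, map_smul, smul_eq_mul]
  ring

theorem altFrom_lcomp {V : Type*} [AddCommGroup V] [Module K V] (a b : Module.End K V) (k : ℕ)
    (f : V →ₗ[K] K) : altFrom (LinearMap.lcomp K K a : Module.End K (V →ₗ[K] K))
      (LinearMap.lcomp K K b : Module.End K (V →ₗ[K] K)) k f = f ∘ₗ altTo b a k := by
  induction k generalizing a b with
  | zero => rfl
  | succ k ih => rw [altFrom_succ, Module.End.mul_apply, ih, altTo_succ]; rfl

theorem altFrom_cellX_cellVec_zero :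
    altFrom (cellX m l n 0) (cellX m l n 1) (2 * n) (cellVec K n 0) = cellVec K n (2 * n) := by
  rw [← altTo_even_eq, isChain_cellVec.altTo_zero le_rfl]

theorem cellVec_mem {p : Submodule K (Fin (2 * n + 1) → K)} (zero : cellVec K n 0 ∈ p)
    (hp : ∀ i, ∀ w ∈ p, cellX m l n i w ∈ p) {a : ℕ} (ha : a ≤ 2 * n) : cellVec K n a ∈ p := by
  induction a with
  | zero => exact zero
  | succ a ih =>
    obtain ⟨k, rfl | rfl⟩ := Nat.even_or_odd' a
    · rw [← isChain_cellVec (m := m) (l := l).up₁ k (by omega)]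
      exact hp 1 _ (ih (by omega))
    · change cellVec K n (2 * k + 2) ∈ p
      rw [← isChain_cellVec (m := m) (l := l).up₀ k (by omega)]
      exact hp 0 _ (ih (by omega))

theorem eq_top_of_cellVec_zero_mem {p : Submodule K (Fin (2 * n + 1) → K)}
    (zero : cellVec K n 0 ∈ p) (hp : ∀ i, ∀ w ∈ p, cellX m l n i w ∈ p) : p = ⊤ := by
  rw [← Submodule.ker_mkQ p, LinearMap.ker_eq_top]
  exact cell_ext fun a ha => (Submodule.Quotient.mk_eq_zero p).2 (cellVec_mem zero hp ha)

variable (hτ : m * τ = l - ((l⁻¹ : Kˣ) : K) + m)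
include hτ

theorem comp_cellY_comp_cellX (i : Fin 2) (f : (Fin (2 * n + 1) → K) →ₗ[K] K) :
    (f ∘ₗ cellY m l τ n i) ∘ₗ cellX m l n i = f := by
  rw [LinearMap.comp_assoc, ← Module.End.mul_eq_comp, cellY_mul_cellX hτ, Module.End.one_eq_id,
    LinearMap.comp_id]

theorem isChain_cellForm : IsChain m (l : K) n
    (LinearMap.lcomp K K (cellX m l n 1)) (LinearMap.lcomp K K (cellX m l n 0))
    (fun a => cellForm l τ n (2 * n - a)) where
  zero := cellForm_comp_cellX hτ 1
  top := by
    rw [Nat.sub_self]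
    exact cellForm_comp_cellX hτ 0
  up₀ k hk := by
    obtain ⟨j, rfl⟩ := Nat.exists_eq_add_of_lt hk
    rw [show 2 * (k + j + 1) - (2 * k + 1) = 2 * j + 1 by omega,
      show 2 * (k + j + 1) - (2 * k + 2) = 2 * j by omega, LinearMap.lcomp_apply',
      ← cellForm_even_comp_cellY_one hτ (by omega), comp_cellY_comp_cellX hτ]
  down₀ k hk := by
    obtain ⟨j, rfl⟩ := Nat.exists_eq_add_of_lt hk
    rw [show 2 * (k + j + 1) - (2 * k + 1) = 2 * j + 1 by omega,
      show 2 * (k + j + 1) - (2 * k + 2) = 2 * j by omega, LinearMap.lcomp_apply',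
      comp_cellX (τ := τ), cellForm_even_comp_cellY_one hτ (by omega),
      cellForm_cellVec _ (eigenIdx_le _ 1)]
    change _ + (m * gram l τ (2 * j) (2 * (k + j + 1))) • cellForm l τ _ _ - _ = _
    rw [gram_of_even (by omega) (by omega), mul_one]
    rfl
  up₁ k hk := by
    obtain ⟨j, rfl⟩ := Nat.exists_eq_add_of_lt hk
    rw [show 2 * (k + j + 1) - (2 * k + 1) = 2 * j + 1 by omega,
      show 2 * (k + j + 1) - 2 * k = 2 * j + 2 by omega, LinearMap.lcomp_apply',
      ← cellForm_odd_comp_cellY_zero hτ (by omega), comp_cellY_comp_cellX hτ]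
  down₁ k hk := by
    obtain ⟨j, rfl⟩ := Nat.exists_eq_add_of_lt hk
    rw [show 2 * (k + j + 1) - (2 * k + 1) = 2 * j + 1 by omega,
      show 2 * (k + j + 1) - 2 * k = 2 * j + 2 by omega, Nat.sub_self, LinearMap.lcomp_apply',
      comp_cellX (τ := τ), cellForm_odd_comp_cellY_zero hτ (by omega),
      cellForm_cellVec _ (eigenIdx_le _ 0)]
    change _ + (m * gram l τ (2 * j + 1) 0) • cellForm l τ _ 0 - _ = _
    rw [gram_of_gt (by omega) (by omega)]

theorem cellForm_zero_comp_altFrom_cellX :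
    cellForm l τ n 0 ∘ₗ altFrom (cellX m l n 1) (cellX m l n 0) (2 * n) =
      cellForm l τ n (2 * n) := by
  simpa only [altFrom_lcomp, altTo_even_eq, Nat.sub_self, Nat.sub_zero] using
    (isChain_cellForm (n := n) hτ).altFrom_top

theorem cellForm_top_comp_altFrom_cellX :
    cellForm l τ n (2 * n) ∘ₗ altFrom (cellX m l n 0) (cellX m l n 1) (2 * n) =
      cellForm l τ n 0 := by
  have mul_eq_one : altFrom (cellY m l τ n 1) (cellY m l τ n 0) (2 * n) *
      altFrom (cellX m l n 0) (cellX m l n 1) (2 * n) = 1 := by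
    simpa [altFrom] using
      altFrom_add_mul_altFrom (cellY_mul_cellX (n := n) hτ 0) (cellY_mul_cellX hτ 1) 0 n
  rw [← cellForm_zero_comp_altFrom_cellY hτ le_rfl, LinearMap.comp_assoc, ← Module.End.mul_eq_comp,
    mul_eq_one, Module.End.one_eq_id, LinearMap.comp_id]

theorem cell_slide (i : Fin 2) :
    altFrom (cellX m l n i) (cellX m l n i.rev) (2 * n) * cellE l τ n i =
      cellE l τ n i.rev * altFrom (cellX m l n i) (cellX m l n i.rev) (2 * n) := by
  refine LinearMap.ext fun v => ?_
  rw [Module.End.mul_apply, Module.End.mul_apply, cellE_apply, cellE_apply, map_smul,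
    ← LinearMap.comp_apply]
  revert i
  refine Fin.forall_fin_two.2 ⟨?_, ?_⟩
  · change cellForm l τ n 0 v • altFrom (cellX m l n 0) (cellX m l n 1) _ (cellVec K n 0) =
      (cellForm l τ n (2 * n) ∘ₗ altFrom (cellX m l n 0) (cellX m l n 1) _) v • cellVec K n (2 * n)
    rw [altFrom_cellX_cellVec_zero, cellForm_top_comp_altFrom_cellX hτ]
  · change cellForm l τ n (2 * n) v •
        altFrom (cellX m l n 1) (cellX m l n 0) _ (cellVec K n (2 * n)) =
      (cellForm l τ n 0 ∘ₗ altFrom (cellX m l n 1) (cellX m l n 0) _) v • cellVec K n 0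
    rw [isChain_cellVec.altFrom_top, cellForm_zero_comp_altFrom_cellX hτ]

theorem cell_braid : altFrom (cellX m l n 0) (cellX m l n 1) (2 * n + 1) =
    altFrom (cellX m l n 1) (cellX m l n 0) (2 * n + 1) := by
  refine braid_of_apply_eq (cellX_mul_cellX hτ) (cell_slide hτ) (cellVec K n 0) ?_
    fun p => eq_top_of_cellVec_zero_mem
  rw [altFrom_odd, Module.End.mul_apply, isChain_cellVec.zero, map_smul,
    altFrom_cellX_cellVec_zero, altFrom_succ, Module.End.mul_apply, altFrom_cellX_cellVec_zero,
    isChain_cellVec.top]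

theorem satisfies_cell : Satisfies m l τ n (cellX m l n) (cellY m l τ n) (cellE l τ n) := by
  have cellE_zero (v : Fin (2 * n + 1) → K) :
      cellE l τ n 0 v = cellForm l τ n 0 v • cellVec K n 0 := rfl
  refine Satisfies.of_zero (cellX_mul_cellY hτ) (cellY_mul_cellX hτ) (cell_braid hτ)
    (fun i => sub_sub_cancel _ _) cellX_mul_cellE (cellE_mul_cellX hτ) cellE_mul_cellE
    (fun k hk => ?_) (fun k hk => ?_) (cell_slide hτ) <;>
    refine LinearMap.ext fun v => ?_ <;>
    rw [Module.End.mul_apply, Module.End.mul_apply, LinearMap.smul_apply, cellE_zero,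
      cellE_zero v, map_smul]
  · rw [← altTo_odd_eq, isChain_cellVec.altTo_zero (by omega), map_smul,
      cellForm_cellVec _ (by omega), gram_of_lt (by omega) (by omega), smul_assoc, smul_comm]
  · rw [map_smul, ← LinearMap.comp_apply, cellForm_zero_comp_altFrom_cellY hτ (by omega),
      cellForm_cellVec _ (by omega), gram_of_gt (by omega) (by omega), smul_assoc, smul_comm]

end CellModuleRelations

section HeckeModule

variable {K : Type*} [CommRing K]

/-- The basis vector of the regular module of the Hecke algebra that stands for the alternating
word of length `k ≤ 2n + 1` that starts with `X_i`. Both words of length `0`, and both words of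
length `2n + 1`, give the same vector. -/
def heckeWord (K : Type*) [CommRing K] (n : ℕ) (i : Fin 2) (k : ℕ) :
    Fin (2 * n + 1) ⊕ Fin (2 * n + 1) → K :=
  if i = 0 ∧ k ≠ 0 ∨ k = 2 * n + 1 then Pi.single (Sum.inr (Fin.ofNat _ (k - 1))) 1
  else Pi.single (Sum.inl (Fin.ofNat _ k)) 1

section

variable {n k : ℕ}

theorem heckeWord_one (hk : k ≤ 2 * n) :
    heckeWord K n 1 k = Pi.single (Sum.inl (Fin.ofNat _ k)) 1 :=
  if_neg (by omega)

theorem heckeWord_zero_succ :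
    heckeWord K n 0 (k + 1) = Pi.single (Sum.inr (Fin.ofNat _ k)) 1 :=
  if_pos (by simp)

theorem heckeWord_length_zero (i j : Fin 2) : heckeWord K n i 0 = heckeWord K n j 0 := by
  simp [heckeWord]

theorem heckeWord_length_top (i j : Fin 2) :
    heckeWord K n i (2 * n + 1) = heckeWord K n j (2 * n + 1) := by
  simp [heckeWord]

variable {W : Type*} [AddCommGroup W] [Module K W]
  {f g : (Fin (2 * n + 1) ⊕ Fin (2 * n + 1) → K) →ₗ[K] W}

theorem hecke_ext_one (h_rev : ∀ k ≤ 2 * n, f (heckeWord K n 1 k) = g (heckeWord K n 1 k))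
    (h : ∀ k ≤ 2 * n, f (heckeWord K n 0 (k + 1)) = g (heckeWord K n 0 (k + 1))) : f = g := by
  refine (Pi.basisFun K _).ext (Sum.rec (fun k => ?_) fun k => ?_) <;> rw [Pi.basisFun_apply]
  · simpa only [heckeWord_one (Nat.le_of_lt_succ k.2), Fin.ofNat_val_eq_self] using
      h_rev k (Nat.le_of_lt_succ k.2)
  · simpa only [heckeWord_zero_succ, Fin.ofNat_val_eq_self] using h k (Nat.le_of_lt_succ k.2)

theorem hecke_ext (i : Fin 2)
    (h_rev : ∀ k ≤ 2 * n, f (heckeWord K n i.rev k) = g (heckeWord K n i.rev k))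
    (h : ∀ k ≤ 2 * n, f (heckeWord K n i (k + 1)) = g (heckeWord K n i (k + 1))) : f = g := by
  revert i
  refine Fin.forall_fin_two.2 ⟨hecke_ext_one, fun h_rev h => hecke_ext_one (fun k hk => ?_)
    fun k hk => ?_⟩
  · rcases k with _ | k
    · rw [heckeWord_length_zero 1 0]
      exact h_rev 0 hk
    · exact h k (by omega)
  · rcases Nat.lt_or_ge k (2 * n) with hk' | hk'
    · exact h_rev (k + 1) hk'
    · obtain rfl : k = 2 * n := by omega
      rw [heckeWord_length_top 0 1]
      exact h _ le_rfl

end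

/-- The action of the `X_i` on the regular module of the Hecke algebra. -/
def heckeX (m : K) (n : ℕ) : Fin 2 → Module.End K (Fin (2 * n + 1) ⊕ Fin (2 * n + 1) → K) :=
  ![(Pi.basisFun K _).constr K (Sum.elim
      (fun k => heckeWord K n 0 (k + 1))
      (fun k => heckeWord K n 1 k - m • heckeWord K n 0 (k + 1))),
    (Pi.basisFun K _).constr K (Sum.elim
      (fun k => if (k : ℕ) = 0 then heckeWord K n 1 1
        else heckeWord K n 0 (k - 1) - m • heckeWord K n 1 k)
      (fun k => if (k : ℕ) = 2 * n then heckeWord K n 0 (2 * n) - m • heckeWord K n 1 (2 * n + 1)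
        else heckeWord K n 1 (k + 2)))]

variable {m : K} {n k : ℕ}

theorem heckeX_zero_single (p : Fin (2 * n + 1) ⊕ Fin (2 * n + 1)) :
    heckeX m n 0 (Pi.single p 1) = Sum.elim
      (fun k : Fin _ => heckeWord K n 0 (k + 1))
      (fun k : Fin _ => heckeWord K n 1 k - m • heckeWord K n 0 (k + 1)) p := by
  rw [heckeX, Matrix.cons_val_zero, ← Pi.basisFun_apply, Module.Basis.constr_basis]

theorem heckeX_one_single (p : Fin (2 * n + 1) ⊕ Fin (2 * n + 1)) :
    heckeX m n 1 (Pi.single p 1) = Sum.elim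
      (fun k : Fin _ => if (k : ℕ) = 0 then heckeWord K n 1 1
        else heckeWord K n 0 (k - 1) - m • heckeWord K n 1 k)
      (fun k : Fin _ => if (k : ℕ) = 2 * n
        then heckeWord K n 0 (2 * n) - m • heckeWord K n 1 (2 * n + 1)
        else heckeWord K n 1 (k + 2)) p := by
  rw [heckeX, Matrix.cons_val_one, Matrix.cons_val_fin_one, ← Pi.basisFun_apply,
    Module.Basis.constr_basis]

theorem val_ofNat_of_le (hk : k ≤ 2 * n) : (Fin.ofNat (2 * n + 1) k : ℕ) = k := by
  rw [Fin.val_ofNat, Nat.mod_eq_of_lt (Nat.lt_succ_of_le hk)]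

theorem heckeX_heckeWord_rev (i : Fin 2) (hk : k ≤ 2 * n) :
    heckeX m n i (heckeWord K n i.rev k) = heckeWord K n i (k + 1) := by
  revert i
  refine Fin.forall_fin_two.2 ⟨?_, ?_⟩
  · change heckeX m n 0 (heckeWord K n 1 k) = _
    rw [heckeWord_one hk, heckeX_zero_single, Sum.elim_inl, val_ofNat_of_le hk]
  · change heckeX m n 1 (heckeWord K n 0 k) = _
    rcases k with _ | k
    · rw [heckeWord_length_zero 0 1, heckeWord_one hk, heckeX_one_single, Sum.elim_inl,
        val_ofNat_of_le hk, if_pos rfl]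
    · rw [heckeWord_zero_succ, heckeX_one_single, Sum.elim_inr, val_ofNat_of_le (by omega),
        if_neg (by omega)]

theorem heckeX_heckeWord (i : Fin 2) (hk : k ≤ 2 * n) :
    heckeX m n i (heckeWord K n i (k + 1)) =
      heckeWord K n i.rev k - m • heckeWord K n i (k + 1) := by
  revert i
  refine Fin.forall_fin_two.2 ⟨?_, ?_⟩
  · rw [heckeWord_zero_succ, heckeX_zero_single, Sum.elim_inr, val_ofNat_of_le hk,
      heckeWord_zero_succ]
    rfl
  · change _ = heckeWord K n 0 k - _
    rcases Nat.lt_or_ge k (2 * n) with hk' | hk'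
    · rw [heckeWord_one hk', heckeX_one_single, Sum.elim_inl, val_ofNat_of_le hk',
        if_neg k.succ_ne_zero, heckeWord_one hk', Nat.succ_sub_one]
    · obtain rfl : k = 2 * n := by omega
      rw [heckeWord_length_top 1 0, heckeWord_zero_succ, heckeX_one_single, Sum.elim_inr,
        val_ofNat_of_le hk, if_pos rfl, heckeWord_length_top 1 0, heckeWord_zero_succ]

theorem heckeX_mul_heckeX (i : Fin 2) : heckeX m n i * heckeX m n i = 1 - m • heckeX m n i := by
  refine hecke_ext i (fun k hk => ?_) (fun k hk => ?_) <;>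
    rw [Module.End.mul_apply, LinearMap.sub_apply, LinearMap.smul_apply, Module.End.one_apply]
  · rw [heckeX_heckeWord_rev i hk, heckeX_heckeWord i hk]
  · rw [heckeX_heckeWord i hk, map_sub, map_smul, heckeX_heckeWord_rev i hk,
      heckeX_heckeWord i hk]

theorem altFrom_heckeX_heckeWord (i : Fin 2) (hk : k ≤ 2 * n + 1) :
    altFrom (heckeX m n i) (heckeX m n i.rev) k (heckeWord K n 0 0) = heckeWord K n i k := by
  induction k generalizing i with
  | zero => exact heckeWord_length_zero 0 i
  | succ k ih =>
    have := ih i.rev (by omega)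
    rw [Fin.rev_rev] at this
    rw [altFrom_succ, Module.End.mul_apply, this, heckeX_heckeWord_rev i (by omega)]

theorem heckeWord_mem {p : Submodule K (Fin (2 * n + 1) ⊕ Fin (2 * n + 1) → K)}
    (zero : heckeWord K n 0 0 ∈ p) (hp : ∀ i, ∀ w ∈ p, heckeX m n i w ∈ p) (i : Fin 2)
    (hk : k ≤ 2 * n + 1) : heckeWord K n i k ∈ p := by
  induction k generalizing i with
  | zero => rwa [heckeWord_length_zero i 0]
  | succ k ih =>
    rw [← heckeX_heckeWord_rev (m := m) i (by omega)]
    exact hp i _ (ih i.rev (by omega))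

theorem eq_top_of_heckeWord_zero_mem {p : Submodule K (Fin (2 * n + 1) ⊕ Fin (2 * n + 1) → K)}
    (zero : heckeWord K n 0 0 ∈ p) (hp : ∀ i, ∀ w ∈ p, heckeX m n i w ∈ p) : p = ⊤ := by
  rw [← Submodule.ker_mkQ p, LinearMap.ker_eq_top]
  exact hecke_ext_one
    (fun k hk => (Submodule.Quotient.mk_eq_zero p).2 (heckeWord_mem zero hp 1 (by omega)))
    (fun k hk => (Submodule.Quotient.mk_eq_zero p).2 (heckeWord_mem zero hp 0 (by omega)))

theorem hecke_braid : altFrom (heckeX m n 0) (heckeX m n 1) (2 * n + 1) =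
    altFrom (heckeX m n 1) (heckeX m n 0) (2 * n + 1) := by
  refine braid_of_apply_eq (c := m) (d := 0) (e := 0) (fun i => ?_) (fun i => ?_)
    (heckeWord K n 0 0) ?_ fun p => eq_top_of_heckeWord_zero_mem
  · rw [heckeX_mul_heckeX, zero_smul, add_zero]
  · rw [Pi.zero_apply, Pi.zero_apply, mul_zero, zero_mul]
  · exact (altFrom_heckeX_heckeWord 0 le_rfl).trans
      ((heckeWord_length_top 0 1).trans (altFrom_heckeX_heckeWord 1 le_rfl).symm)

theorem satisfies_hecke (m : K) (l : Kˣ) (τ : K) (n : ℕ) :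
    Satisfies m l τ n (heckeX m n) (fun i => heckeX m n i + m • 1) 0 where
  x_mul_y i := by rw [mul_add, heckeX_mul_heckeX, mul_smul_comm, mul_one, sub_add_cancel]
  y_mul_x i := by rw [add_mul, heckeX_mul_heckeX, smul_mul_assoc, one_mul, sub_add_cancel]
  braid := hecke_braid
  skein i := by simp
  x_mul_e := by simp
  e_mul_x := by simp
  e_mul_e := by simp
  e_x_e := by simp
  e_y_e := by simp
  slide := by simp

end HeckeModule

section Independence

variable {K : Type*} [CommRing K] {m : K} {l : Kˣ} {τ : K} {n : ℕ}

/-- The Gram matrix of the cell module, whose rows are the functionals `cellForm`. -/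
def gramMatrix (l : Kˣ) (τ : K) (n : ℕ) : Matrix (Fin (2 * n + 1)) (Fin (2 * n + 1)) K :=
  Matrix.of fun b a => gram l τ b a

theorem span_range_cellForm (hG : IsUnit (gramMatrix l τ n).det) :
    Submodule.span K (Set.range fun b : Fin (2 * n + 1) => cellForm l τ n b) = ⊤ := by
  refine eq_top_iff.2 fun f _ => ?_
  set c := Matrix.vecMul (fun a => f (Pi.single a 1)) (gramMatrix l τ n)⁻¹ with hc
  have f_eq : f = ∑ b, c b • cellForm l τ n b := by
    refine cell_ext fun a ha => ?_
    obtain ⟨i, rfl⟩ : ∃ i : Fin (2 * n + 1), (i : ℕ) = a := ⟨⟨a, Nat.lt_succ_of_le ha⟩, rfl⟩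
    calc f (cellVec K n i) = Matrix.vecMul c (gramMatrix l τ n) i := by
          rw [hc, Matrix.vecMul_vecMul, Matrix.nonsing_inv_mul _ hG,
            Matrix.vecMul_one, cellVec_val]
      _ = (∑ b, c b • cellForm l τ n b) (cellVec K n i) := by
          simp [LinearMap.sum_apply, cellForm_cellVec _ ha, Matrix.vecMul, dotProduct,
            gramMatrix]
  rw [f_eq]
  exact Submodule.sum_mem _ fun b _ => Submodule.smul_mem _ _ (Submodule.subset_span ⟨b, rfl⟩)

theorem altTo_mul_cellE_mul_altFrom (hτ : m * τ = l - ((l⁻¹ : Kˣ) : K) + m)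
    (a b : Fin (2 * n + 1)) :
    altTo (cellX m l n 0) (cellX m l n 1) a * cellE l τ n 0 *
      altFrom (cellY m l τ n 1) (cellY m l τ n 0) b =
      (cellForm l τ n b).smulRight (Pi.single a 1) := by
  refine LinearMap.ext fun v => ?_
  rw [Module.End.mul_apply, Module.End.mul_apply, cellE_apply, map_smul]
  change _ • altTo (cellX m l n 0) (cellX m l n 1) a (cellVec K n 0) = _
  rw [isChain_cellVec.altTo_zero (Nat.le_of_lt_succ a.2), cellVec_val, ← LinearMap.comp_apply]
  change (cellForm l τ n 0 ∘ₗ _) v • _ = _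
  rw [cellForm_zero_comp_altFrom_cellY hτ (Nat.le_of_lt_succ b.2), LinearMap.smulRight_apply]

theorem twoSidedCell_cell_eq_top (hτ : m * τ = l - ((l⁻¹ : Kˣ) : K) + m)
    (hG : IsUnit (gramMatrix l τ n).det) :
    twoSidedCell K n (cellX m l n) (cellE l τ n) = ⊤ := by
  have h := satisfies_cell (n := n) hτ
  have cellForm_mem (a b : Fin (2 * n + 1)) : (cellForm l τ n b).smulRight (Pi.single a 1) ∈
      twoSidedCell K n (cellX m l n) (cellE l τ n) := by
    rw [← altTo_mul_cellE_mul_altFrom hτ]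
    refine mul_altFrom_mem (fun _ => h.mul_y_mem_twoSidedCell 1)
      (fun _ => h.mul_y_mem_twoSidedCell 0) b (Submodule.subset_span ⟨(a, 0), ?_⟩)
    exact mul_one (altTo (cellX m l n 0) (cellX m l n 1) a * cellE l τ n 0)
  have smulRight_mem (a : Fin (2 * n + 1)) : ⊤ ≤ (twoSidedCell K n (cellX m l n)
      (cellE l τ n)).comap (LinearMap.smulRightₗ.flip (Pi.single a 1)) := by
    rw [← span_range_cellForm hG, Submodule.span_le]
    rintro _ ⟨b, rfl⟩
    exact cellForm_mem a b
  refine eq_top_iff.2 fun T _ => ?_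
  have T_eq : T = ∑ a, (LinearMap.proj a ∘ₗ T).smulRight (Pi.single a 1) := by
    refine LinearMap.ext fun v => ?_
    simpa [LinearMap.sum_apply, ← Pi.single_smul] using (Finset.univ_sum_single (T v)).symm
  rw [T_eq]
  exact Submodule.sum_mem _ fun a _ => smulRight_mem a Submodule.mem_top

theorem linearIndependent_sigmaOf_cell [Nontrivial K]
    (hτ : m * τ = l - ((l⁻¹ : Kˣ) : K) + m) (hG : IsUnit (gramMatrix l τ n).det) :
    LinearIndependent K (sigmaOf n (cellX m l n) (cellE l τ n) ∘ Sum.inr) := by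
  refine linearIndependent_of_top_le_span_of_card_eq_finrank
    (twoSidedCell_cell_eq_top hτ hG).ge ?_
  simp [Module.finrank_linearMap]

theorem Satisfies.lift_sigmaGen {A : Type*} [Ring A] [Algebra K A] {x y e : Fin 2 → A}
    (h : Satisfies m l τ n x y e) (i : SigmaIdx n) :
    h.lift (sigmaGen m l τ n i) = sigmaOf n x e i := by
  rw [sigmaGen, map_sigmaOf]
  congr 1 <;> exact funext fun i => h.lift_gen _

theorem sigmaOf_hecke_inl (m : K) (n : ℕ) (i : Fin (2 * n + 1) ⊕ Fin (2 * n + 1)) :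
    sigmaOf n (heckeX m n) 0 (Sum.inl i) (heckeWord K n 0 0) = Pi.single i 1 := by
  rcases i with i | j
  · refine (altFrom_heckeX_heckeWord 1 (by omega)).trans ?_
    rw [heckeWord_one (by omega), Fin.ofNat_val_eq_self]
  · refine (altFrom_heckeX_heckeWord 0 (by omega)).trans ?_
    rw [heckeWord_zero_succ, Fin.ofNat_val_eq_self]

theorem linearIndependent_sigmaGen_of_isUnit_det [Nontrivial K]
    (hτ : m * τ = l - ((l⁻¹ : Kˣ) : K) + m) (hG : IsUnit (gramMatrix l τ n).det) :
    LinearIndependent K (sigmaGen m l τ n) := by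
  set f : BMW K m l τ n →ₗ[K] (Fin (2 * n + 1) ⊕ Fin (2 * n + 1) → K) :=
    LinearMap.applyₗ (heckeWord K n 0 0) ∘ₗ (satisfies_hecke m l τ n).lift.toLinearMap
  have f_inl : f ∘ sigmaGen m l τ n ∘ Sum.inl = fun i => Pi.single i 1 := by
    refine funext fun i => ?_
    exact (LinearMap.congr_fun ((satisfies_hecke m l τ n).lift_sigmaGen _) _).trans
      (sigmaOf_hecke_inl m n i)
  have f_inr (p : Fin (2 * n + 1) × Fin (2 * n + 1)) : f (sigmaGen m l τ n (Sum.inr p)) = 0 := by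
    refine (LinearMap.congr_fun ((satisfies_hecke m l τ n).lift_sigmaGen _) _).trans ?_
    simp [sigmaOf]
  have inl_indep : LinearIndependent K (f ∘ sigmaGen m l τ n ∘ Sum.inl) := by
    rw [f_inl]
    exact Pi.linearIndependent_single_one _ K
  refine linearIndependent_sum.2 ⟨inl_indep.of_comp f, ?_,
    (Submodule.range_ker_disjoint inl_indep).mono_right (Submodule.span_le.2 ?_)⟩
  · refine LinearIndependent.of_comp (satisfies_cell hτ).lift.toLinearMap ?_
    convert! linearIndependent_sigmaOf_cell (n := n) hτ hG using 1
    exact funext fun p => (satisfies_cell hτ).lift_sigmaGen _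
  · rintro _ ⟨p, rfl⟩
    exact f_inr p

end Independence

section UniversalCoefficients

/-- The polynomial over `ℤ[m, t]` whose root is `l` if `m t = l - l⁻¹`. Here `t` stands for
`τ - 1`. -/
def universalPoly : (MvPolynomial (Fin 2) ℤ)[X] :=
  Polynomial.X ^ 2 - Polynomial.C (MvPolynomial.X 0 * MvPolynomial.X 1) * Polynomial.X - 1

theorem eval₂_universalPoly {R : Type*} [CommRing R] (f : MvPolynomial (Fin 2) ℤ →+* R) (x : R) :
    universalPoly.eval₂ f x = x ^ 2 - f (MvPolynomial.X 0 * MvPolynomial.X 1) * x - 1 := by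
  simp only [universalPoly, Polynomial.eval₂_sub, Polynomial.eval₂_mul, Polynomial.eval₂_pow,
    Polynomial.eval₂_X, Polynomial.eval₂_C, Polynomial.eval₂_one]

theorem universalPoly_monic : universalPoly.Monic := by
  rw [universalPoly]
  monicity!

theorem universalPoly_natDegree : universalPoly.natDegree = 2 := by
  rw [universalPoly]
  compute_degree!

theorem universalPoly_irreducible : Irreducible universalPoly := by
  rw [universalPoly_monic.irreducible_iff_roots_eq_zero_of_degree_le_three
    universalPoly_natDegree.ge (by rw [universalPoly_natDegree]; norm_num)]
  refine Multiset.eq_zero_of_forall_notMem fun r hr => ?_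
  set φ : MvPolynomial (Fin 2) ℤ →+* ℤ := MvPolynomial.eval fun _ => 1
  have eq_one : φ r * (φ r - 1) = 1 := by
    have root : φ r ^ 2 - φ (MvPolynomial.X 0 * MvPolynomial.X 1) * φ r - 1 = 0 := by
      rw [← eval₂_universalPoly, Polynomial.eval₂_hom, Polynomial.isRoot_of_mem_roots hr, map_zero]
    rw [map_mul, MvPolynomial.eval_X, MvPolynomial.eval_X] at root
    linarith
  have even := Int.even_mul_pred_self (φ r)
  rw [eq_one] at even
  exact absurd even (by decide)

/-- The universal ring of coefficients `ℤ[m, l^{±1}, τ] / (m τ - l + l⁻¹ - m)`. -/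
abbrev UniversalRing : Type := AdjoinRoot universalPoly

instance : IsDomain UniversalRing :=
  AdjoinRoot.isDomain_of_prime universalPoly_irreducible.prime

/-- The parameter `m` of the universal ring. -/
def universalM : UniversalRing := AdjoinRoot.of universalPoly (MvPolynomial.X 0)

/-- The parameter `τ` of the universal ring. -/
def universalTau : UniversalRing := AdjoinRoot.of universalPoly (MvPolynomial.X 1) + 1

theorem root_mul_root_sub : AdjoinRoot.root universalPoly * (AdjoinRoot.root universalPoly -
    AdjoinRoot.of universalPoly (MvPolynomial.X 0 * MvPolynomial.X 1)) = 1 := by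
  linear_combination (eval₂_universalPoly _ _).symm.trans (AdjoinRoot.eval₂_root universalPoly)

/-- The parameter `l` of the universal ring. -/
def universalL : UniversalRingˣ where
  val := AdjoinRoot.root universalPoly
  inv := AdjoinRoot.root universalPoly -
    AdjoinRoot.of universalPoly (MvPolynomial.X 0 * MvPolynomial.X 1)
  val_inv := root_mul_root_sub
  inv_val := by rw [mul_comm, root_mul_root_sub]

theorem universalM_mul_universalTau : universalM * universalTau =
    universalL - ((universalL⁻¹ : UniversalRingˣ) : UniversalRing) + universalM := by
  change _ = AdjoinRoot.root universalPoly - (AdjoinRoot.root universalPoly - _) + _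
  rw [universalM, universalTau, map_mul]
  ring

variable {R : Type*} [CommRing R] {m : R} {l : Rˣ} {τ : R}

theorem exists_universal_ringHom (hτ : m * τ = l - ((l⁻¹ : Rˣ) : R) + m) :
    ∃ f : UniversalRing →+* R, f universalM = m ∧
      Units.map (f : UniversalRing →* R) universalL = l ∧ f universalTau = τ := by
  have root_eq : universalPoly.eval₂
      (MvPolynomial.eval₂Hom (Int.castRingHom R) ![m, τ - 1]) (l : R) = 0 := by
    rw [eval₂_universalPoly, map_mul]
    simp only [MvPolynomial.coe_eval₂Hom, MvPolynomial.eval₂_X, Matrix.cons_val_zero,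
      Matrix.cons_val_one]
    linear_combination (-l : R) * hτ + l.mul_inv
  refine ⟨AdjoinRoot.lift _ _ root_eq, ?_, Units.ext (AdjoinRoot.lift_root root_eq), ?_⟩
  · simp [universalM]
  · simp [universalTau]

theorem map_gram {S : Type*} [CommRing S] (f : S →+* R) (l : Sˣ) (τ : S) (b a : ℕ) :
    f (gram l τ b a) = gram (Units.map (f : S →* R) l) (f τ) b a := by
  rw [gram, gram, ← map_inv]
  split_ifs <;> simp

theorem map_det_gramMatrix {S : Type*} [CommRing S] (f : S →+* R) (l : Sˣ) (τ : S) (n : ℕ) :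
    f (gramMatrix l τ n).det = (gramMatrix (Units.map (f : S →* R) l) (f τ) n).det := by
  rw [RingHom.map_det]
  congr 1
  ext b a
  exact map_gram f l τ b a

-- At `m = 0`, `l = 1` the Gram matrix is a characteristic matrix in the variable `τ - 1`.
theorem det_gramMatrix_universal_ne_zero (n : ℕ) :
    (gramMatrix universalL universalTau n).det ≠ 0 := by
  obtain ⟨f, -, f_l, f_τ⟩ := exists_universal_ringHom (R := ℤ[X]) (m := 0) (l := 1)
    (τ := Polynomial.X + 1) (by simp)
  have gramMatrix_eq : gramMatrix (1 : ℤ[X]ˣ) (Polynomial.X + 1) n =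
      (Matrix.of fun _ _ => (-1 : ℤ)).charmatrix := by
    ext b a : 1
    rcases eq_or_ne a b with rfl | hab
    · simp [gramMatrix, gram]
    · simp [gramMatrix, gram, hab.symm, Fin.val_ne_of_ne hab]
  intro det_eq_zero
  have charpoly_eq_zero : (Matrix.of fun _ _ : Fin (2 * n + 1) => (-1 : ℤ)).charpoly = 0 := by
    rw [Matrix.charpoly, ← gramMatrix_eq, ← f_l, ← f_τ, ← map_det_gramMatrix, det_eq_zero, map_zero]
  exact (Matrix.charpoly_monic _).ne_zero charpoly_eq_zero

end UniversalCoefficients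

section SigmaBasis

variable {R S : Type*} [CommRing R] [CommRing S] [Algebra R S]

/-- The homomorphism between the algebras with the same presentation over `R` and over the
`R`-algebra `S`. -/
def scalarExtension (S : Type*) [CommRing S] [Algebra R S] (m : R) (l : Rˣ) (τ : R) (n : ℕ) :
    BMW R m l τ n →ₐ[R]
      BMW S (algebraMap R S m) (Units.map (algebraMap R S) l) (algebraMap R S τ) n :=
  (satisfies_algebraMap_iff.1 (satisfies_gen (algebraMap R S m) _ _ n)).lift

theorem scalarExtension_gen (m : R) (l : Rˣ) (τ : R) (n : ℕ) (g : Gen) :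
    scalarExtension S m l τ n (gen m l τ n g) = gen _ _ _ n g :=
  (Satisfies.lift_gen _ g).trans (by cases g <;> rfl)

theorem scalarExtension_sigmaGen (m : R) (l : Rˣ) (τ : R) (n : ℕ) (i : SigmaIdx n) :
    scalarExtension S m l τ n (sigmaGen m l τ n i) = sigmaGen _ _ _ n i :=
  Satisfies.lift_sigmaGen _ i

theorem linearIndependent_sigmaGen_of_faithful [FaithfulSMul R S] {m : R} {l : Rˣ} {τ : R} {n : ℕ}
    (h : LinearIndependent S (sigmaGen (algebraMap R S m) (Units.map (algebraMap R S) l)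
      (algebraMap R S τ) n)) : LinearIndependent R (sigmaGen m l τ n) := by
  refine LinearIndependent.of_comp (scalarExtension S m l τ n).toLinearMap ?_
  convert! h.restrict_scalars' R using 1
  exact funext (scalarExtension_sigmaGen m l τ n)

theorem linearIndependent_sigmaGen_algebraMap {m : R} {l : Rˣ} {τ : R} {n : ℕ}
    (h : LinearIndependent R (sigmaGen m l τ n)) :
    LinearIndependent S (sigmaGen (algebraMap R S m) (Units.map (algebraMap R S) l)
      (algebraMap R S τ) n) := by
  have sat := satisfies_algebraMap_iff (R := S).2 <| (satisfies_gen m l τ n).map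
    (Algebra.TensorProduct.includeRight : _ →ₐ[R] S ⊗[R] BMW R m l τ n)
  set b := Module.Basis.mk h (span_sigmaGen m l τ n).ge
  refine LinearIndependent.of_comp sat.lift.toLinearMap ?_
  convert! (b.baseChange S).linearIndependent using 1
  refine funext fun i => ?_
  rw [Module.Basis.baseChange_apply, Module.Basis.mk_apply]
  exact (sat.lift_sigmaGen i).trans
    (map_sigmaOf (Algebra.TensorProduct.includeRight : _ →ₐ[R] S ⊗[R] BMW R m l τ n) _ _ _ i).symm

theorem linearIndependent_sigmaGen_universal (n : ℕ) :
    LinearIndependent UniversalRing (sigmaGen universalM universalL universalTau n) := by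
  refine linearIndependent_sigmaGen_of_faithful (S := FractionRing UniversalRing)
    (linearIndependent_sigmaGen_of_isUnit_det ?_ ?_)
  · simpa using! congrArg (algebraMap UniversalRing (FractionRing UniversalRing))
      universalM_mul_universalTau
  · refine isUnit_iff_ne_zero.2 fun det_eq_zero => det_gramMatrix_universal_ne_zero n ?_
    refine IsFractionRing.injective UniversalRing (FractionRing UniversalRing) ?_
    rw [map_det_gramMatrix, map_zero]
    exact det_eq_zero

section

variable {m : R} {l : Rˣ} {τ : R} (hτ : m * τ = l - ((l⁻¹ : Rˣ) : R) + m) (n : ℕ)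

include hτ in
theorem linearIndependent_sigmaGen : LinearIndependent R (sigmaGen m l τ n) := by
  obtain ⟨f, rfl, rfl, rfl⟩ := exists_universal_ringHom hτ
  let := f.toAlgebra
  exact linearIndependent_sigmaGen_algebraMap (linearIndependent_sigmaGen_universal n)

/-- The family `Σ` as a basis of the presented algebra. -/
def sigmaBasis : Module.Basis (SigmaIdx n) R (BMW R m l τ n) :=
  Module.Basis.mk (linearIndependent_sigmaGen hτ n) (span_sigmaGen m l τ n).ge

theorem sigmaBasis_apply (i : SigmaIdx n) : sigmaBasis hτ n i = sigmaGen m l τ n i :=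
  Module.Basis.mk_apply _ _ i

include hτ in
theorem algebraMap_mul_eq : algebraMap R S m * algebraMap R S τ =
    (Units.map (algebraMap R S) l : Sˣ) -
      ((Units.map (algebraMap R S) l)⁻¹ : Sˣ) + algebraMap R S m := by
  simpa using! congrArg (algebraMap R S) hτ

theorem scalarExtension_sigmaBasis (i : SigmaIdx n) :
    scalarExtension S m l τ n (sigmaBasis hτ n i) = sigmaBasis (algebraMap_mul_eq hτ) n i := by
  rw [sigmaBasis_apply, sigmaBasis_apply, scalarExtension_sigmaGen]

theorem sigmaBasis_repr_scalarExtension (z : BMW R m l τ n) (i : SigmaIdx n) :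
    (sigmaBasis (algebraMap_mul_eq hτ) n).repr (scalarExtension S m l τ n z) i =
      algebraMap R S ((sigmaBasis hτ n).repr z i) := by
  have expand : scalarExtension S m l τ n z = ∑ i, algebraMap R S ((sigmaBasis hτ n).repr z i) •
      sigmaBasis (algebraMap_mul_eq hτ) n i := by
    conv_lhs => rw [← (sigmaBasis hτ n).sum_repr z, map_sum]
    simp only [map_smul, scalarExtension_sigmaBasis, algebraMap_smul]
  rw [expand, Module.Basis.repr_sum_self]

include hτ in
theorem scalarExtension_injective [FaithfulSMul R S] :
    Function.Injective (scalarExtension S m l τ n) := by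
  refine fun z w hzw => (sigmaBasis hτ n).ext_elem fun i => FaithfulSMul.algebraMap_injective R S ?_
  rw [← sigmaBasis_repr_scalarExtension, hzw, sigmaBasis_repr_scalarExtension]

theorem toSubmodule_range_scalarExtension (m : R) (l : Rˣ) (τ : R) :
    Subalgebra.toSubmodule (scalarExtension S m l τ n).range = Submodule.span R (Set.range
      (sigmaGen (algebraMap R S m) (Units.map (algebraMap R S) l) (algebraMap R S τ) n)) := by
  calc Subalgebra.toSubmodule (scalarExtension S m l τ n).range
      = Submodule.map (scalarExtension S m l τ n).toLinearMap ⊤ := by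
        rw [Submodule.map_top]
        rfl
    _ = _ := by
      rw [← span_sigmaGen, Submodule.map_span, ← Set.range_comp]
      exact congrArg (fun s => Submodule.span R (Set.range s))
        (funext (scalarExtension_sigmaGen m l τ n))

end

end SigmaBasis

theorem mLam_mul_tau (R : Subalgebra Lam FLam) (hτ : tau ∈ R) :
    algebraMap Lam R mLam * ⟨tau, hτ⟩ = (Units.map (algebraMap Lam R) lLam : Rˣ) -
      (((Units.map (algebraMap Lam R) lLam)⁻¹ : Rˣ) : R) + algebraMap Lam R mLam := by
  have m_ne_zero : algebraMap Lam FLam mLam ≠ 0 := by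
    rw [Ne, map_eq_zero_iff _ (IsFractionRing.injective Lam FLam)]
    exact AddMonoidAlgebra.single_ne_zero.2 Polynomial.X_ne_zero
  refine Subtype.ext ?_
  calc algebraMap Lam FLam mLam * tau = algebraMap Lam FLam (lLam : Lam) -
        algebraMap Lam FLam ((lLam⁻¹ : Lamˣ) : Lam) + algebraMap Lam FLam mLam := by
        rw [tau, mul_add, mul_div_cancel₀ _ m_ne_zero, mul_one]
    _ = _ := rfl

end DihedralBMW

end

open DihedralBMW in
theorem mainTheorem3_general {R K : Type*} [CommRing R] [Nontrivial R] [CommRing K] [Algebra R K]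
    [FaithfulSMul R K] {m : R} {l : Rˣ} {τ : R} (hτ : m * τ = l - ((l⁻¹ : Rˣ) : R) + m) (n : ℕ) :
    (∃ b : Module.Basis (SigmaIdx n) K (BMW K (algebraMap R K m) (Units.map (algebraMap R K) l)
        (algebraMap R K τ) n),
      (∀ i, b i = sigmaGen _ _ _ n i) ∧
      ∀ i j k, b.repr (b i * b j) k ∈ Set.range (algebraMap R K)) ∧
    (∃ A : Subalgebra R (BMW K (algebraMap R K m) (Units.map (algebraMap R K) l)
        (algebraMap R K τ) n),
      Subalgebra.toSubmodule A = Submodule.span R (Set.range (sigmaGen _ _ _ n)) ∧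
      ∃ e : BMW R m l τ n ≃ₐ[R] A, ∀ g : Gen, (e (gen m l τ n g) : BMW K (algebraMap R K m)
        (Units.map (algebraMap R K) l) (algebraMap R K τ) n) = gen _ _ _ n g) ∧
    Module.Free R (BMW R m l τ n) ∧ Module.Finite R (BMW R m l τ n) ∧
    Module.finrank R (BMW R m l τ n) = 2 * (2 * n + 1) + (2 * n + 1) ^ 2 := by
  refine ⟨⟨sigmaBasis (algebraMap_mul_eq hτ) n, sigmaBasis_apply _ n, fun i j k => ?_⟩,
    ⟨(scalarExtension K m l τ n).range, toSubmodule_range_scalarExtension n m l τ,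
      AlgEquiv.ofInjective _ (scalarExtension_injective hτ n), scalarExtension_gen m l τ n⟩,
    Module.Free.of_basis (sigmaBasis hτ n), Module.Finite.of_basis (sigmaBasis hτ n), ?_⟩
  · refine ⟨(sigmaBasis hτ n).repr (sigmaBasis hτ n i * sigmaBasis hτ n j) k, ?_⟩
    rw [← sigmaBasis_repr_scalarExtension, map_mul, scalarExtension_sigmaBasis,
      scalarExtension_sigmaBasis]
  · rw [Module.finrank_eq_card_basis (sigmaBasis hτ n), Fintype.card_sum, Fintype.card_sum,
      Fintype.card_prod, Fintype.card_fin]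
    ring

theorem mainTheorem3 (n : ℕ) (hn : 1 ≤ n)
    (R : Subalgebra DihedralBMW.Lam DihedralBMW.FLam) (hτ : DihedralBMW.tau ∈ R) :
    -- `Σ` is a basis of the algebra over the field, with structure constants in `R`,
    (∃ b : Module.Basis (DihedralBMW.SigmaIdx n) DihedralBMW.FLam (DihedralBMW.B n),
      (∀ i, b i = DihedralBMW.sigma n i) ∧ ∀ i j k, b.repr (b i * b j) k ∈ R) ∧
    -- the span `A_n` of `Σ` is an `R`-algebra, naturally isomorphic to the integral form,
    (∃ A : Subalgebra R (DihedralBMW.B n),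
      Subalgebra.toSubmodule A = DihedralBMW.An R n ∧
      ∃ e : DihedralBMW.BBar R hτ n ≃ₐ[R] A,
        ∀ g : DihedralBMW.Gen,
          (e (DihedralBMW.bBarGen R hτ n g) : DihedralBMW.B n) = DihedralBMW.bGen n g) ∧
    -- and the integral form is free of the stated rank.
    Module.Free R (DihedralBMW.BBar R hτ n) ∧
    Module.Finite R (DihedralBMW.BBar R hτ n) ∧
    Module.finrank R (DihedralBMW.BBar R hτ n) = 2 * (2 * n + 1) + (2 * n + 1) ^ 2 := by
  have h := mainTheorem3_general (R := R) (K := DihedralBMW.FLam) (DihedralBMW.mLam_mul_tau R hτ) n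
  rwa [show Set.range (algebraMap R DihedralBMW.FLam) = R from Subtype.range_coe] at h
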